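/- There are universal constants $A,B,C>0$ and $m\in\mathbb{N}$ and a single classical program (finitely many registers holding exact real numbers, read-only input arrays; unit-cost operations $+,-,\times,/,\cos,\sin$, rational constants, comparisons and array look-ups) such that the following holds. Let $H$ be a Hermitian matrix (a Hamiltonian, e.g. on $n$ qubits) with smallest eigenvalue $\lambda_0$, let $\Pi_0$ be the orthogonal projection onto the $\lambda_0$-eigenspace, $\rho$ a density matrix, and $p_0=\mathrm{Tr}[\rho\Pi_0]$. Let $\tau>0$ with $\tau\|H\|<\pi/3$, let $\epsilon>0$ with $\tau\epsilon<\pi/6$, let $0<\vartheta<1$, and suppose $p_0\ge\eta$ for a known $\eta>0$. Put $\delta=\tfrac23\tau\epsilon$, $$d=\Big\lceil A\,\epsilon^{-1}\tau^{-1}\log(\epsilon^{-1}\tau^{-1}\eta^{-1})\Big\rceil,\qquad M=\Big\lceil B\,\eta^{-2}\log^2(d)\,\max\{1,\ \log\log(\epsilon^{-1}\tau^{-1})+\log\vartheta^{-1}\}\Big\rceil .$$ *Samples.* Let $\Theta$ be the $2\pi$-periodic Heaviside function ($1$ on $[2k\pi,(2k+1)\pi)$, $0$ on $[(2k-1)\pi,2k\pi)$,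 $k\in\mathbb Z$), let $M_{d,\delta}(x)$ be $T_d\big(1+2\frac{\cos x-\cos\delta}{1+\cos\delta}\big)$ ($T_d$ the Chebyshev polynomial of the first kind) divided by its integral over $[-\pi,\pi]$, let $F(x)=\int_{-\pi}^{\pi}M_{d,\delta}(y)\Theta(x-y)\,dy$, and let $\hat F_j=\frac1{2\pi}\int_{-\pi}^{\pi}F(x)e^{-ijx}dx=|\hat F_j|e^{i\theta_j}$ and $\mathcal F=\sum_{|j|\le d}|\hat F_j|$. A sample is a pair $(J,Z)$ with $\Pr[J=j]=|\hat F_j|/\mathcal F$ for $|j|\le d$ and, given $J=j$, $Z=X+iY$ with $X$ and $Y$ independent, where $X$ (respectively $Y$) is $1$ or $-1$ according to whether the outcome is $0$ or $1$ in the following one-ancilla circuit with $W=I$ (respectively $W=S^\dagger$, $S$ the phase gate): apply to $|0\rangle\langle0|\otimes\rho$ a Hadamard gate on the ancilla, then $e^{-ij\tau H}$ controlled by the ancilla, then $W$ and a Hadamard gate on the ancilla, and measure the ancilla. Let $(J_k,Z_k)_{k=1}^M$ be $M$ independent samples. Then this sample distribution is a well-defined probability distribution, and: 1. *(Accuracy.)*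 The program, given $\epsilon,\tau,\eta,\vartheta,d,M$, the samples $(J_k,Z_k)_{k\le M}$, the number $\mathcal F$ and the table $(\theta_j)_{|j|\le d}$, outputs with probability at least $1-\vartheta$ a number $\widetilde\lambda_0$ with $|\widetilde\lambda_0-\lambda_0|\le\epsilon$. 2. *(Classical cost.)* For all values of the samples it halts after at most $C\,\eta^{-2}\log^m(\epsilon^{-1}\tau^{-1}\eta^{-1})\,(1+\log\vartheta^{-1})$ steps. 3. *(Expected total evolution time.)* $\mathbb E\big[\sum_{k=1}^M 2\tau|J_k|\big]\le C\,\epsilon^{-1}\eta^{-2}\log^m(\epsilon^{-1}\tau^{-1}\eta^{-1})\,(1+\log\vartheta^{-1})$ (each sample uses two circuit runs of evolution time $\tau|J_k|$). 4. *(Maximal evolution time.)* Almost surely $\tau|J_k|\le\tau d$ for all $k$, and $\tau d\le C\,\epsilon^{-1}\log^m(\epsilon^{-1}\tau^{-1}\eta^{-1})$. -/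

import Mathlib

open scoped Matrix Kronecker ComplexOrder

noncomputable section

namespace GroundEnergy

/-! ### The approximate Heaviside function -/

open Classical in
/-- The `2π`-periodic Heaviside function: `1` on `[2kπ, (2k+1)π)`, `0` on `[(2k-1)π, 2kπ)`. -/
def heaviside (x : ℝ) : ℝ :=
  if ∃ k : ℤ, 2 * k * Real.pi ≤ x ∧ x < (2 * k + 1) * Real.pi then 1 else 0

/-- The Chebyshev bump `T_d (1 + 2 (cos x - cos δ) / (1 + cos δ))`. -/
def bump (d : ℕ) (δ x : ℝ) : ℝ :=
  (Polynomial.Chebyshev.T ℝ (d : ℤ)).eval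
    (1 + 2 * ((Real.cos x - Real.cos δ) / (1 + Real.cos δ)))

/-- The mollifier `M_{d,δ}`: the bump divided by its integral over a period. -/
def mollifier (d : ℕ) (δ x : ℝ) : ℝ :=
  bump d δ x / ∫ y in (-Real.pi)..Real.pi, bump d δ y

/-- The approximate Heaviside function `F_{d,δ} = M_{d,δ} * H` (periodic convolution). -/
def approxHeaviside (d : ℕ) (δ x : ℝ) : ℝ :=
  ∫ y in (-Real.pi)..Real.pi, mollifier d δ y * heaviside (x - y)

/-- The Fourier coefficients of `F_{d,δ}`, normalized so that `F(x) = ∑_{|j| ≤ d} F̂_j e^{ijx}`. -/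
def coeff (d : ℕ) (δ : ℝ) (j : ℤ) : ℂ :=
  (1 / (2 * Real.pi) : ℂ) * ∫ x in (-Real.pi)..Real.pi,
    (approxHeaviside d δ x : ℂ) * Complex.exp (-(Complex.I * j * x))

/-- `𝓕 = ∑_{|j| ≤ d} |F̂_j|`. -/
def coeffNorm (d : ℕ) (δ : ℝ) : ℝ :=
  ∑ j ∈ Finset.Icc (-(d : ℤ)) d, ‖coeff d δ j‖

/-! ### The Hadamard-test circuit -/

section Circuit

/-- The Hadamard gate. -/
def hadamardGate : Matrix (Fin 2) (Fin 2) ℂ :=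
  ((1 / Real.sqrt 2 : ℝ) : ℂ) • !![1, 1; 1, -1]

/-- The phase gate `S`. -/
def phaseGate : Matrix (Fin 2) (Fin 2) ℂ :=
  !![1, 0; 0, Complex.I]

/-- The projector `|b⟩⟨b|` of the ancilla qubit. -/
def ancillaProj (b : Fin 2) : Matrix (Fin 2) (Fin 2) ℂ :=
  Matrix.single b b 1

variable {ι : Type} [Fintype ι] [DecidableEq ι]

/-- The time evolution operator `e^{-itH}`. -/
def evolution (H : Matrix ι ι ℂ) (t : ℝ) : Matrix ι ι ℂ :=
  NormedSpace.exp ((-(Complex.I * t)) • H)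

/-- `U` controlled by the ancilla qubit. -/
def controlled (U : Matrix ι ι ℂ) : Matrix (Fin 2 × ι) (Fin 2 × ι) ℂ :=
  ancillaProj 0 ⊗ₖ (1 : Matrix ι ι ℂ) + ancillaProj 1 ⊗ₖ U

/-- The circuit, read from right to left: Hadamard on the ancilla, controlled `U`, `W` on the
ancilla, Hadamard on the ancilla. -/
def circuit (W : Matrix (Fin 2) (Fin 2) ℂ) (U : Matrix ι ι ℂ) :
    Matrix (Fin 2 × ι) (Fin 2 × ι) ℂ :=
  (hadamardGate ⊗ₖ (1 : Matrix ι ι ℂ)) * (W ⊗ₖ (1 : Matrix ι ι ℂ)) * controlled U *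
    (hadamardGate ⊗ₖ (1 : Matrix ι ι ℂ))

/-- The probability of the outcome `b` when the ancilla is measured after the circuit has been
applied to `|0⟩⟨0| ⊗ ρ`. -/
def outcomeProb (W : Matrix (Fin 2) (Fin 2) ℂ) (U ρ : Matrix ι ι ℂ) (b : Fin 2) : ℝ :=
  ((ancillaProj b ⊗ₖ (1 : Matrix ι ι ℂ)) *
    (circuit W U * (ancillaProj 0 ⊗ₖ ρ) * (circuit W U)ᴴ)).trace.re

/-- The random variable attached to the outcome: `1` for outcome `0`, `-1` for outcome `1`. -/
def outcomeValue (b : Fin 2) : ℂ := if b = 0 then 1 else -1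

/-- The law of one sample `(J, Z)`: `J = j` with probability `|F̂_j| / 𝓕`, and, given `J = j`,
`Z = X + iY` with `X` from a run of the circuit with `W = I` and `Y` from an independent run
with `W = S†`, both with the evolution `e^{-ijτH}`. -/
def sampleLaw (H ρ : Matrix ι ι ℂ) (τ : ℝ) (d : ℕ) (δ : ℝ) : MeasureTheory.Measure (ℤ × ℂ) :=
  ∑ j ∈ Finset.Icc (-(d : ℤ)) d, ∑ a : Fin 2, ∑ b : Fin 2,
    ENNReal.ofReal (‖coeff d δ j‖ / coeffNorm d δ
      * outcomeProb 1 (evolution H (j * τ)) ρ a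
      * outcomeProb phaseGateᴴ (evolution H (j * τ)) ρ b) •
    MeasureTheory.Measure.dirac (j, outcomeValue a + outcomeValue b * Complex.I)

/-- The law of `M` independent samples `(J_k, Z_k)`. -/
def samplesLaw (H ρ : Matrix ι ι ℂ) (τ : ℝ) (d : ℕ) (δ : ℝ) (M : ℕ) :
    MeasureTheory.Measure (Fin M → ℤ × ℂ) :=
  MeasureTheory.Measure.pi fun _ => sampleLaw H ρ τ d δ

/-- The operator norm of a matrix for the Euclidean norm. -/
def opNorm (H : Matrix ι ι ℂ) : ℝ :=
  ‖Matrix.toEuclideanCLM (n := ι) (𝕜 := ℂ) H‖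

/-- The orthogonal projection onto the `μ`-eigenspace of `H`, as a matrix. -/
def eigenProj (H : Matrix ι ι ℂ) (μ : ℝ) : Matrix ι ι ℂ :=
  (Matrix.toEuclideanCLM (n := ι) (𝕜 := ℂ)).symm
    (Module.End.eigenspace (Matrix.toEuclideanLin H) (μ : ℂ)).starProjection

end Circuit

/-! ### Classical post-processing: programs over exact real registers, with a step count -/

/-- Unit-cost operations. The registers are numbered by naturals and hold reals; `dst` is the
register written to. Division by zero gives `0`. `read dst n i` looks up the entry of the
read-only input array `n` at the index held by register `i`. -/
inductive Op where
  | const (dst : ℕ) (q : ℚ)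
  | add (dst a b : ℕ)
  | sub (dst a b : ℕ)
  | mul (dst a b : ℕ)
  | div (dst a b : ℕ)
  | cos (dst a : ℕ)
  | sin (dst a : ℕ)
  | read (dst n i : ℕ)

/-- Array lookup at a real index; an index that is not an integer gives `0`. -/
def lookup (A : ℤ → ℝ) (x : ℝ) : ℝ := if (⌊x⌋ : ℝ) = x then A ⌊x⌋ else 0

/-- The effect of an operation on the registers `s`, with input arrays `A`. -/
def Op.apply (A : ℕ → ℤ → ℝ) (s : ℕ → ℝ) : Op → ℕ → ℝ
  | .const r q => Function.update s r (q : ℝ)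
  | .add r a b => Function.update s r (s a + s b)
  | .sub r a b => Function.update s r (s a - s b)
  | .mul r a b => Function.update s r (s a * s b)
  | .div r a b => Function.update s r (s a / s b)
  | .cos r a => Function.update s r (Real.cos (s a))
  | .sin r a => Function.update s r (Real.sin (s a))
  | .read r n i => Function.update s r (lookup (A n) (s i))

/-- Programs. `ifLt a b p q` and `whileLt a b p` test whether register `a` is less than
register `b`. -/
inductive Prog where
  | op (o : Op)
  | seq (p q : Prog)
  | ifLt (a b : ℕ) (p q : Prog)
  | whileLt (a b : ℕ) (p : Prog)

/-- `Exec A p s s' t`: with input arrays `A`, the program `p` started with registers `s` halts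
with registers `s'` after exactly `t` operations and tests. -/
inductive Exec (A : ℕ → ℤ → ℝ) : Prog → (ℕ → ℝ) → (ℕ → ℝ) → ℕ → Prop where
  | op (o : Op) (s : ℕ → ℝ) : Exec A (.op o) s (o.apply A s) 1
  | seq {p q : Prog} {s s' s'' : ℕ → ℝ} {m n : ℕ} :
      Exec A p s s' m → Exec A q s' s'' n → Exec A (.seq p q) s s'' (m + n)
  | if_true {a b : ℕ} {p q : Prog} {s s' : ℕ → ℝ} {m : ℕ} :
      s a < s b → Exec A p s s' m → Exec A (.ifLt a b p q) s s' (m + 1)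
  | if_false {a b : ℕ} {p q : Prog} {s s' : ℕ → ℝ} {m : ℕ} :
      ¬ s a < s b → Exec A q s s' m → Exec A (.ifLt a b p q) s s' (m + 1)
  | while_true {a b : ℕ} {p : Prog} {s s' s'' : ℕ → ℝ} {m n : ℕ} :
      s a < s b → Exec A p s s' m → Exec A (.whileLt a b p) s' s'' n →
      Exec A (.whileLt a b p) s s'' (m + n + 1)
  | while_false {a b : ℕ} {p : Prog} {s : ℕ → ℝ} :
      ¬ s a < s b → Exec A (.whileLt a b p) s s 1

/-- Execution is deterministic: final registers and step count are determined by the input. -/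
theorem Exec.unique {A : ℕ → ℤ → ℝ} {p : Prog} {s s₁ s₂ : ℕ → ℝ} {m n : ℕ}
    (h₁ : Exec A p s s₁ m) (h₂ : Exec A p s s₂ n) : s₁ = s₂ ∧ m = n := by
  induction h₁ generalizing s₂ n with
  | op o s => cases h₂; exact ⟨rfl, rfl⟩
  | seq _ _ ihp ihq =>
    cases h₂ with
    | seq hp hq =>
      obtain ⟨rfl, rfl⟩ := ihp hp
      obtain ⟨rfl, rfl⟩ := ihq hq
      exact ⟨rfl, rfl⟩
  | if_true h _ ih =>
    cases h₂ with
    | if_true _ hp => obtain ⟨rfl, rfl⟩ := ih hp; exact ⟨rfl, rfl⟩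
    | if_false h' _ => exact absurd h h'
  | if_false h _ ih =>
    cases h₂ with
    | if_true h' _ => exact absurd h' h
    | if_false _ hp => obtain ⟨rfl, rfl⟩ := ih hp; exact ⟨rfl, rfl⟩
  | while_true h _ _ ihp ihq =>
    cases h₂ with
    | while_true _ hp hq =>
      obtain ⟨rfl, rfl⟩ := ihp hp
      obtain ⟨rfl, rfl⟩ := ihq hq
      exact ⟨rfl, rfl⟩
    | while_false h' => exact absurd h h'
  | while_false h =>
    cases h₂ with
    | while_true h' _ _ => exact absurd h' h
    | while_false _ => exact ⟨rfl, rfl⟩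

/-- Initial registers of the post-processing: the known parameters `ε, τ, η, ϑ, d, M, 𝓕` in the
registers `0, …, 6`, and `0` elsewhere. -/
def initRegs (ε τ η ϑ : ℝ) (d : ℕ) (δ : ℝ) (M : ℕ) : ℕ → ℝ
  | 0 => ε
  | 1 => τ
  | 2 => η
  | 3 => ϑ
  | 4 => d
  | 5 => M
  | 6 => coeffNorm d δ
  | _ => 0

/-- Input arrays of the post-processing: arrays `0, 1, 2` hold `J_k`, `Re Z_k`, `Im Z_k` at the
index `k = 0, …, M - 1`; array `3` holds the phase `θ_j` of `F̂_j` at the index `j`, `|j| ≤ d`.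
All other entries are `0`. -/
def inputArrays (d : ℕ) (δ : ℝ) {M : ℕ} (w : Fin M → ℤ × ℂ) : ℕ → ℤ → ℝ
  | 0, z => if h : 0 ≤ z ∧ z.toNat < M then ((w ⟨z.toNat, h.2⟩).1 : ℝ) else 0
  | 1, z => if h : 0 ≤ z ∧ z.toNat < M then (w ⟨z.toNat, h.2⟩).2.re else 0
  | 2, z => if h : 0 ≤ z ∧ z.toNat < M then (w ⟨z.toNat, h.2⟩).2.im else 0
  | 3, z => if |z| ≤ (d : ℤ) then (coeff d δ z).arg else 0
  | _, _ => 0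

/-! ### The parameters -/

/-- `d = ⌈A ε⁻¹ τ⁻¹ log (ε⁻¹ τ⁻¹ η⁻¹)⌉`. -/
def degree (A ε τ η : ℝ) : ℕ :=
  ⌈A * ε⁻¹ * τ⁻¹ * Real.log (ε⁻¹ * τ⁻¹ * η⁻¹)⌉₊

/-- `M = ⌈B η⁻² log² d max (1, log log (ε⁻¹ τ⁻¹) + log ϑ⁻¹)⌉`. -/
def numSamples (B ε τ η ϑ : ℝ) (d : ℕ) : ℕ :=
  ⌈B * (η ^ 2)⁻¹ * Real.log d ^ 2
    * max 1 (Real.log (Real.log (ε⁻¹ * τ⁻¹)) + Real.log ϑ⁻¹)⌉₊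

end GroundEnergy

end

open GroundEnergy

/-! Let `w_k` be the weight of `ρ` on the `k`-th eigenvector, with eigenvalue `λ_k`. The function
`F` is a trigonometric polynomial of degree at most `d` that imitates the Heaviside function, so
`C(x) = ∑ w_k F(x - τ λ_k)` (`smoothedCDF`) is a smoothed cumulative distribution function of the
spectral measure of `τH`. It is almost `0` for query points at least `δ` below `τλ₀` and almost `η`
or more at least `δ` above it (`smoothedCDF_le`, `le_smoothedCDF`). The error is governed by `π /
bumpIntegral`. Chebyshev growth makes `bumpIntegral` exponentially large in `d δ`, so the stated `d`
brings the error down to `η/15` (`le_bumpIntegral_degree`).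

Expanding `F` gives `C(x) = ∑ F̂_j e^{ijx} Tr[ρ e^{-ijτH}]`. Given `J = j`, the Hadamard test
returns `Z` with mean `Tr[ρ e^{-ijτH}]`, hence `𝓕 Re(e^{i(θ_J + Jx)} Z)` is an unbiased estimator of
`C(x)` (`integral_estimateTerm`). It is bounded by `2𝓕`, and `𝓕 = O(log d)` because `|F̂_j| ≤ 1/|j|`
(`coeffNorm_le`). Hoeffding's inequality then gives precision `η/4` at a fixed `x` from `O(η⁻² log²
d)` samples, up to the confidence factor (`estimate_deviation`).

The program bisects with threshold `η/2`. A decision can go either way within `δ` of `τλ₀`;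
elsewhere it is right as soon as the estimate is accurate, and the final midpoint is then within
`3δ/2 = τε` of `τλ₀` (`abs_bisect_sub_le`). The same samples serve all adaptive queries. This is
harmless: as long as the estimates are accurate, level `l` only queries one of at most four dyadic
points fixed in advance (`card_reachable_le`). A union bound over `4L` points with `L =
O(log(ε⁻¹τ⁻¹))` suffices, which is where `log log(ε⁻¹τ⁻¹)` in `M` comes from (`union_bound_le`). -/

noncomputable section

namespace GroundEnergy

/-! ### Bounds for the Chebyshev bump -/

theorem continuous_bump (d : ℕ) (δ : ℝ) : Continuous (bump d δ) := by
  unfold bump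
  fun_prop

theorem bump_periodic (d : ℕ) (δ : ℝ) : Function.Periodic (bump d δ) (2 * Real.pi) := by
  intro x
  simp [bump, Real.cos_add_two_pi]

theorem abs_bump_le_one {d : ℕ} {δ x : ℝ} (hδ : 0 < 1 + Real.cos δ)
    (hx : Real.cos x ≤ Real.cos δ) : |bump d δ x| ≤ 1 := by
  apply Polynomial.Chebyshev.abs_eval_T_real_le_one
  rw [abs_le]
  have h1 : (Real.cos x - Real.cos δ) / (1 + Real.cos δ) ≤ 0 :=
    div_nonpos_of_nonpos_of_nonneg (by linarith) hδ.le
  have h2 : -1 ≤ (Real.cos x - Real.cos δ) / (1 + Real.cos δ) := by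
    rw [le_div_iff₀ hδ]
    linarith [Real.neg_one_le_cos x]
  constructor <;> linarith

theorem neg_one_le_bump {d : ℕ} {δ : ℝ} (hδ : 0 < 1 + Real.cos δ) (x : ℝ) :
    -1 ≤ bump d δ x := by
  rcases le_total (Real.cos x) (Real.cos δ) with h | h
  · exact (abs_le.1 (abs_bump_le_one hδ h)).1
  · refine le_trans (by norm_num) (Polynomial.Chebyshev.one_le_eval_T_real (d : ℤ) ?_)
    have : 0 ≤ (Real.cos x - Real.cos δ) / (1 + Real.cos δ) :=
      div_nonneg (by linarith) hδ.le
    linarith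

theorem abs_bump_le_add_two {d : ℕ} {δ : ℝ} (hδ : 0 < 1 + Real.cos δ) (x : ℝ) :
    |bump d δ x| ≤ bump d δ x + 2 := by
  rw [abs_le]
  have := neg_one_le_bump (d := d) hδ x
  constructor <;> linarith

/-- With `y = cosh v` and `v ≥ u`, the value is `cosh (d v)`, which is at least `e^{dv} / 2`. -/
theorem exp_half_le_eval_T (d : ℕ) {u y : ℝ} (hu : 0 ≤ u) (hy : Real.cosh u ≤ y) :
    Real.exp (d * u) / 2 ≤ (Polynomial.Chebyshev.T ℝ (d : ℤ)).eval y := by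
  have hy1 : 1 ≤ y := (Real.one_le_cosh u).trans hy
  rw [← Real.cosh_arcosh hy1] at hy
  have h := Real.cosh_le_cosh.1 hy
  rw [abs_of_nonneg hu, abs_of_nonneg (Real.arcosh_nonneg hy1)] at h
  rw [← Real.cosh_arcosh hy1, Polynomial.Chebyshev.T_real_cosh, Real.cosh_eq]
  have h1 : Real.exp (d * u) ≤ Real.exp (((d : ℤ) : ℝ) * Real.arcosh y) := by
    apply Real.exp_le_exp.2
    push_cast
    exact mul_le_mul_of_nonneg_left h (Nat.cast_nonneg d)
  linarith [Real.exp_pos (-(((d : ℤ) : ℝ) * Real.arcosh y))]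

/-- Here `cos y - cos δ ≥ δ²/5 - δ²/8 = 3δ²/40` and `1 + cos δ ≤ 2`, so the argument of `T_d` is at
least `1 + 3δ²/40`. This exceeds `1 + δ²/16`, which bounds `cosh (δ/4)`. -/
theorem exp_half_le_bump {d : ℕ} {δ y : ℝ} (h0 : 0 < δ) (h1 : δ ≤ 1) (hy : |y| ≤ δ / 2) :
    Real.exp (d * (δ / 4)) / 2 ≤ bump d δ y := by
  have hpi := Real.pi_gt_three
  have hpi2 : Real.pi ^ 2 ≤ 10 := by nlinarith [Real.pi_lt_d2, Real.pi_pos]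
  apply exp_half_le_eval_T d (by linarith)
  have hcy : 1 - δ ^ 2 / 8 ≤ Real.cos y := by
    have := Real.one_sub_sq_div_two_le_cos (x := y)
    have h3 : y ^ 2 ≤ (δ / 2) ^ 2 := by
      rw [← sq_abs]; exact pow_le_pow_left₀ (abs_nonneg y) hy 2
    nlinarith
  have hcd : Real.cos δ ≤ 1 - δ ^ 2 / 5 := by
    have := Real.cos_le_one_sub_mul_cos_sq (x := δ) (by rw [abs_of_pos h0]; linarith)
    have h3 : 1 / 5 ≤ 2 / Real.pi ^ 2 := by
      rw [div_le_div_iff₀ (by norm_num) (by positivity)]; linarith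
    nlinarith [sq_nonneg δ]
  have hcpos : 0 < Real.cos δ := Real.cos_pos_of_le_one (by rw [abs_of_pos h0]; exact h1)
  have h4 : (Real.cos y - Real.cos δ) / 2 ≤ (Real.cos y - Real.cos δ) / (1 + Real.cos δ) := by
    apply div_le_div_of_nonneg_left (by nlinarith [sq_nonneg δ]) (by linarith)
      (by linarith [Real.cos_le_one δ])
  have h5 : Real.cosh (δ / 4) ≤ 1 + δ ^ 2 / 16 := by
    refine (Real.cosh_le_exp_half_sq _).trans ?_
    have h6 : (δ / 4) ^ 2 / 2 ≤ 1 := by nlinarith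
    have h7 := Real.abs_exp_sub_one_le (x := (δ / 4) ^ 2 / 2)
      (by rw [abs_of_nonneg (by positivity)]; exact h6)
    rw [abs_of_nonneg (a := (δ / 4) ^ 2 / 2) (by positivity)] at h7
    have := (abs_le.1 h7).2
    nlinarith
  nlinarith [sq_nonneg δ]

/-- The integral of the bump over a period. -/
def bumpIntegral (d : ℕ) (δ : ℝ) : ℝ := ∫ y in (-Real.pi)..Real.pi, bump d δ y

/-- Since `bump + 1 ≥ 0`, its integral can only drop when restricted to `[-δ/2, δ/2]`; the added
constant costs `2π`. -/
theorem le_bumpIntegral {d : ℕ} {δ : ℝ} (h0 : 0 < δ) (h1 : δ ≤ 1) :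
    δ * Real.exp (d * (δ / 4)) / 2 - 2 * Real.pi ≤ bumpIntegral d δ := by
  have hpi := Real.pi_gt_three
  have hδ : 0 < 1 + Real.cos δ := by
    linarith [Real.cos_pos_of_le_one (x := δ) (by rw [abs_of_pos h0]; exact h1)]
  have hc := continuous_bump d δ
  have hi : ∀ a b, IntervalIntegrable (fun y => bump d δ y + 1) MeasureTheory.volume a b :=
    fun a b => (hc.add continuous_const).intervalIntegrable a b
  have e1 : ∫ y in (-Real.pi)..Real.pi, (bump d δ y + 1) = bumpIntegral d δ + 2 * Real.pi := by
    rw [intervalIntegral.integral_add (hc.intervalIntegrable _ _)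
      (continuous_const.intervalIntegrable _ _)]
    simp [bumpIntegral]
    ring
  have e2 : ∫ y in (-(δ / 2))..(δ / 2), (bump d δ y + 1) ≤
      ∫ y in (-Real.pi)..Real.pi, (bump d δ y + 1) := by
    apply intervalIntegral.integral_mono_interval (by linarith) (by linarith) (by linarith) _
      (hi _ _)
    exact Filter.Eventually.of_forall fun y => by
      have := neg_one_le_bump (d := d) hδ y
      simp only [Pi.zero_apply]
      linarith
  have e3 : ∫ _ in (-(δ / 2))..(δ / 2), (Real.exp (d * (δ / 4)) / 2) ≤
      ∫ y in (-(δ / 2))..(δ / 2), (bump d δ y + 1) := by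
    apply intervalIntegral.integral_mono_on (by linarith)
      (continuous_const.intervalIntegrable _ _) (hi _ _)
    intro y hy
    have := exp_half_le_bump (d := d) h0 h1 (y := y) (abs_le.2 ⟨hy.1, hy.2⟩)
    linarith
  rw [intervalIntegral.integral_const, smul_eq_mul] at e3
  linarith

/-! ### The mollifier -/

theorem mollifier_eq (d : ℕ) (δ x : ℝ) : mollifier d δ x = bump d δ x / bumpIntegral d δ := rfl

theorem continuous_mollifier (d : ℕ) (δ : ℝ) : Continuous (mollifier d δ) :=
  (continuous_bump d δ).div_const _

theorem mollifier_periodic (d : ℕ) (δ : ℝ) :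
    Function.Periodic (mollifier d δ) (2 * Real.pi) := by
  intro x
  rw [mollifier_eq, mollifier_eq, bump_periodic]

theorem integral_mollifier {d : ℕ} {δ : ℝ} (hI : 0 < bumpIntegral d δ) (a : ℝ) :
    ∫ y in a..a + 2 * Real.pi, mollifier d δ y = 1 := by
  rw [(mollifier_periodic d δ).intervalIntegral_add_eq a (-Real.pi)]
  have : -Real.pi + 2 * Real.pi = Real.pi := by ring
  rw [this]
  simp only [mollifier_eq]
  rw [intervalIntegral.integral_div]
  exact div_self hI.ne'

/-- The bump is never below `-1`, so its absolute value exceeds it by at most `2`: the mollifier is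
nearly nonnegative in the mean. -/
theorem integral_abs_mollifier_le {d : ℕ} {δ : ℝ} (hδ : 0 < 1 + Real.cos δ)
    (hI : 0 < bumpIntegral d δ) :
    ∫ y in (-Real.pi)..Real.pi, |mollifier d δ y| ≤ 1 + 4 * Real.pi / bumpIntegral d δ := by
  have hc := continuous_bump d δ
  have h1 : ∫ y in (-Real.pi)..Real.pi, |mollifier d δ y| ≤
      ∫ y in (-Real.pi)..Real.pi, (bump d δ y + 2) / bumpIntegral d δ := by
    apply intervalIntegral.integral_mono_on (by linarith [Real.pi_pos])
      ((continuous_mollifier d δ).abs.intervalIntegrable _ _)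
      (((hc.add continuous_const).div_const _).intervalIntegrable _ _)
    intro y _
    rw [mollifier_eq, abs_div, abs_of_pos hI]
    exact div_le_div_of_nonneg_right (abs_bump_le_add_two hδ y) hI.le
  refine h1.trans (le_of_eq ?_)
  rw [intervalIntegral.integral_div, intervalIntegral.integral_add (hc.intervalIntegrable _ _)
      (continuous_const.intervalIntegrable _ _), ← bumpIntegral]
  simp only [intervalIntegral.integral_const, smul_eq_mul]
  field_simp
  ring

/-! ### The approximate Heaviside function -/

theorem heaviside_periodic : Function.Periodic heaviside (2 * Real.pi) := by
  intro x
  unfold heaviside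
  congr 1
  apply propext
  constructor
  · rintro ⟨k, h1, h2⟩
    refine ⟨k - 1, ?_, ?_⟩ <;> push_cast <;> linarith
  · rintro ⟨k, h1, h2⟩
    refine ⟨k + 1, ?_, ?_⟩ <;> push_cast <;> linarith

theorem heaviside_of_mem {x : ℝ} (h0 : 0 ≤ x) (h1 : x < Real.pi) : heaviside x = 1 :=
  if_pos ⟨0, by simpa using h0, by simpa using h1⟩

theorem heaviside_of_neg {x : ℝ} (h0 : -Real.pi ≤ x) (h1 : x < 0) : heaviside x = 0 := by
  apply if_neg
  rintro ⟨k, h2, h3⟩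
  have hpi := Real.pi_pos
  rcases lt_or_ge k 0 with hk | hk
  · have : (k : ℝ) ≤ -1 := by exact_mod_cast Int.le_sub_one_of_lt hk
    nlinarith
  · have : (0 : ℝ) ≤ k := by exact_mod_cast hk
    nlinarith

theorem approxHeaviside_eq (d : ℕ) (δ x : ℝ) :
    approxHeaviside d δ x = ∫ z in (0 : ℝ)..Real.pi, mollifier d δ (x - z) := by
  have hpi := Real.pi_pos
  have h1 : approxHeaviside d δ x =
      ∫ z in (x - Real.pi)..(x + Real.pi), mollifier d δ (x - z) * heaviside z := by
    have := intervalIntegral.integral_comp_sub_left (a := -Real.pi) (b := Real.pi)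
      (fun z => mollifier d δ (x - z) * heaviside z) x
    simp only [sub_sub_cancel, sub_neg_eq_add] at this
    exact this
  have hper : Function.Periodic (fun z => mollifier d δ (x - z) * heaviside z)
      (2 * Real.pi) := by
    intro z
    simp only [heaviside_periodic z]
    rw [← mollifier_periodic d δ (x - (z + 2 * Real.pi))]
    congr 2
    ring
  -- By periodicity the window of integration moves to `[-π, π]`, where the Heaviside function is
  -- the indicator of `[0, π)`.
  have h2 := hper.intervalIntegral_add_eq (x - Real.pi) (-Real.pi)
  have e1 : x - Real.pi + 2 * Real.pi = x + Real.pi := by ring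
  have e2 : -Real.pi + 2 * Real.pi = Real.pi := by ring
  rw [e1, e2] at h2
  have hcm : Continuous fun z => mollifier d δ (x - z) :=
    (continuous_mollifier d δ).comp (continuous_const.sub continuous_id)
  have hneg : Set.EqOn (fun z => mollifier d δ (x - z) * heaviside z) (fun _ => 0)
      (Set.Ioo (-Real.pi) 0) := fun z hz => by
    simp [heaviside_of_neg hz.1.le hz.2]
  have hpos : Set.EqOn (fun z => mollifier d δ (x - z) * heaviside z)
      (fun z => mollifier d δ (x - z)) (Set.Ioo 0 Real.pi) := fun z hz => by
    simp [heaviside_of_mem hz.1.le hz.2]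
  have i1 : IntervalIntegrable (fun z => mollifier d δ (x - z) * heaviside z)
      MeasureTheory.volume (-Real.pi) 0 := by
    refine (intervalIntegrable_congr_uIoo (g := fun _ => (0 : ℝ)) ?_).2
      (continuous_const.intervalIntegrable _ _)
    rwa [Set.uIoo_of_le (by linarith)]
  have i2 : IntervalIntegrable (fun z => mollifier d δ (x - z) * heaviside z)
      MeasureTheory.volume 0 Real.pi := by
    refine (intervalIntegrable_congr_uIoo (g := fun z => mollifier d δ (x - z)) ?_).2
      (hcm.intervalIntegrable _ _)
    rwa [Set.uIoo_of_le (by linarith)]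
  rw [h1, h2, ← intervalIntegral.integral_add_adjacent_intervals i1 i2]
  have j1 : ∫ z in (-Real.pi)..0, mollifier d δ (x - z) * heaviside z = 0 := by
    rw [intervalIntegral.integral_congr_uIoo (g := fun _ => (0 : ℝ))]
    · simp
    · rwa [Set.uIoo_of_le (by linarith)]
  rw [j1, zero_add]
  apply intervalIntegral.integral_congr_uIoo
  rwa [Set.uIoo_of_le (by linarith)]

theorem approxHeaviside_eq_integral (d : ℕ) (δ x : ℝ) :
    approxHeaviside d δ x = ∫ y in (x - Real.pi)..x, mollifier d δ y := by
  rw [approxHeaviside_eq]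
  simp

theorem neg_le_approxHeaviside {d : ℕ} {δ : ℝ} (hδ : 0 < 1 + Real.cos δ)
    (hI : 0 < bumpIntegral d δ) (x : ℝ) :
    -(Real.pi / bumpIntegral d δ) ≤ approxHeaviside d δ x := by
  rw [approxHeaviside_eq_integral]
  have : ∫ _ in (x - Real.pi)..x, (-1 / bumpIntegral d δ) ≤
      ∫ y in (x - Real.pi)..x, mollifier d δ y := by
    apply intervalIntegral.integral_mono_on (by linarith [Real.pi_pos])
      (continuous_const.intervalIntegrable _ _)
      ((continuous_mollifier d δ).intervalIntegrable _ _)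
    intro y _
    exact div_le_div_of_nonneg_right (neg_one_le_bump hδ y) hI.le
  rw [intervalIntegral.integral_const, smul_eq_mul] at this
  refine le_trans (le_of_eq ?_) this
  ring

theorem abs_integral_mollifier_le {d : ℕ} {δ a b : ℝ} (hδ : 0 < 1 + Real.cos δ)
    (hI : 0 < bumpIntegral d δ) (hab : a ≤ b)
    (h : ∀ y ∈ Set.Icc a b, Real.cos y ≤ Real.cos δ) :
    |∫ y in a..b, mollifier d δ y| ≤ (b - a) / bumpIntegral d δ := by
  have := intervalIntegral.norm_integral_le_of_norm_le_const (a := a) (b := b)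
    (f := mollifier d δ) (C := 1 / bumpIntegral d δ) (fun y hy => by
      rw [Set.uIoc_of_le hab] at hy
      rw [mollifier_eq, Real.norm_eq_abs, abs_div, abs_of_pos hI]
      exact div_le_div_of_nonneg_right (abs_bump_le_one hδ (h y ⟨hy.1.le, hy.2⟩)) hI.le)
  rw [Real.norm_eq_abs, abs_of_nonneg (sub_nonneg.2 hab)] at this
  refine this.trans (le_of_eq ?_)
  ring

theorem cos_le_cos_of_mem {δ y : ℝ} (h0 : 0 ≤ δ) (h1 : δ ≤ y) (h2 : y ≤ 2 * Real.pi - δ) :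
    Real.cos y ≤ Real.cos δ := by
  rcases le_total y Real.pi with h | h
  · exact Real.cos_le_cos_of_nonneg_of_le_pi h0 h h1
  · rw [← Real.cos_two_pi_sub y]
    exact Real.cos_le_cos_of_nonneg_of_le_pi h0 (by linarith) (by linarith)

/-- The window `[x - π, x]` lies in `[-2π + δ, -δ]`, away from the peaks of the bump, where `|bump|
≤ 1`. -/
theorem abs_approxHeaviside_le {d : ℕ} {δ x : ℝ} (hδ : 0 < 1 + Real.cos δ)
    (hI : 0 < bumpIntegral d δ) (h0 : 0 ≤ δ) (h1 : -Real.pi + δ ≤ x) (h2 : x ≤ -δ) :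
    |approxHeaviside d δ x| ≤ Real.pi / bumpIntegral d δ := by
  rw [approxHeaviside_eq_integral]
  have := abs_integral_mollifier_le (a := x - Real.pi) (b := x) hδ hI
    (by linarith [Real.pi_pos]) (fun y hy => by
      rw [← Real.cos_neg]
      exact cos_le_cos_of_mem h0 (by linarith [hy.2]) (by linarith [hy.1]))
  simpa using this

/-- The total mass over a period is `1`, and the complementary half-period `[x, x + π]` avoids the
peaks. -/
theorem one_sub_le_approxHeaviside {d : ℕ} {δ x : ℝ} (hδ : 0 < 1 + Real.cos δ)
    (hI : 0 < bumpIntegral d δ) (h0 : 0 ≤ δ) (h1 : δ ≤ x) (h2 : x ≤ Real.pi - δ) :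
    1 - Real.pi / bumpIntegral d δ ≤ approxHeaviside d δ x := by
  rw [approxHeaviside_eq_integral]
  have := abs_integral_mollifier_le (a := x) (b := x + Real.pi) hδ hI
    (by linarith [Real.pi_pos]) (fun y hy =>
      cos_le_cos_of_mem h0 (by linarith [hy.1]) (by linarith [hy.2]))
  rw [add_sub_cancel_left] at this
  have e := integral_mollifier hI (x - Real.pi)
  have hc := continuous_mollifier d δ
  rw [show x - Real.pi + 2 * Real.pi = x + Real.pi by ring,
    ← intervalIntegral.integral_add_adjacent_intervals (hc.intervalIntegrable _ x)
      (hc.intervalIntegrable x _)] at e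
  linarith [(abs_le.1 this).2]

end GroundEnergy

namespace GroundEnergy

/-! ### Fourier expansion of the approximate Heaviside function -/

/-- The character `y ↦ e^{ijy}`. -/
def expChar (j : ℤ) (y : ℝ) : ℂ := Complex.exp (Complex.I * j * y)

theorem continuous_expChar (j : ℤ) : Continuous (expChar j) := by
  unfold expChar
  fun_prop

theorem expChar_zero (y : ℝ) : expChar 0 y = 1 := by simp [expChar]

theorem expChar_add (i j : ℤ) (y : ℝ) : expChar (i + j) y = expChar i y * expChar j y := by
  rw [expChar, expChar, expChar, ← Complex.exp_add]
  congr 1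
  push_cast
  ring

theorem expChar_sub_arg (j : ℤ) (x z : ℝ) :
    expChar j (x - z) = expChar j x * expChar (-j) z := by
  rw [expChar, expChar, expChar, ← Complex.exp_add]
  congr 1
  push_cast
  ring

theorem norm_expChar (j : ℤ) (y : ℝ) : ‖expChar j y‖ = 1 := by
  rw [expChar, show Complex.I * j * y = ((j * y : ℝ) : ℂ) * Complex.I by push_cast; ring]
  exact Complex.norm_exp_ofReal_mul_I _

theorem ofReal_cos_eq_expChar (y : ℝ) :
    (Real.cos y : ℂ) = 1 / 2 * expChar 1 y + 1 / 2 * expChar (-1) y := by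
  rw [Complex.ofReal_cos, Complex.cos, expChar, expChar]
  push_cast
  rw [show Complex.I * 1 * (y : ℂ) = y * Complex.I by ring,
    show Complex.I * -1 * (y : ℂ) = -y * Complex.I by ring]
  ring

/-- The trigonometric polynomials of degree at most `n`. -/
def trigPolys (n : ℕ) : Submodule ℂ (ℝ → ℂ) :=
  Submodule.span ℂ (expChar '' (Finset.Icc (-(n : ℤ)) n : Finset ℤ))

theorem expChar_mem_trigPolys {n : ℕ} {j : ℤ} (h : j ∈ Finset.Icc (-(n : ℤ)) n) :
    expChar j ∈ trigPolys n :=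
  Submodule.subset_span ⟨j, h, rfl⟩

theorem cos_mul_mem_trigPolys {n : ℕ} {f : ℝ → ℂ} (hf : f ∈ trigPolys n) :
    (fun y => (Real.cos y : ℂ) * f y) ∈ trigPolys (n + 1) := by
  induction hf using Submodule.span_induction with
  | mem f h =>
    obtain ⟨j, hj, rfl⟩ := h
    have hj : j ∈ Finset.Icc (-(n : ℤ)) n := hj
    rw [Finset.mem_Icc] at hj
    have : (fun y => (Real.cos y : ℂ) * expChar j y) =
        (1 / 2 : ℂ) • expChar (1 + j) + (1 / 2 : ℂ) • expChar (-1 + j) := by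
      funext y
      simp only [Pi.add_apply, Pi.smul_apply, smul_eq_mul, ofReal_cos_eq_expChar, expChar_add]
      ring
    rw [this]
    refine add_mem (Submodule.smul_mem _ _ (expChar_mem_trigPolys ?_))
      (Submodule.smul_mem _ _ (expChar_mem_trigPolys ?_)) <;>
    · rw [Finset.mem_Icc]
      push_cast
      constructor <;> linarith
  | zero => simp only [Pi.zero_apply, mul_zero]; exact zero_mem _
  | add f g _ _ hf hg =>
    simp only [Pi.add_apply, mul_add]
    exact add_mem hf hg
  | smul a f _ hf =>
    have : (fun y => (Real.cos y : ℂ) * (a • f) y) =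
        a • fun y => (Real.cos y : ℂ) * f y := by
      funext y
      simp only [Pi.smul_apply, smul_eq_mul]
      ring
    rw [this]
    exact Submodule.smul_mem _ _ hf

theorem trigPolys_mono {m n : ℕ} (h : m ≤ n) : trigPolys m ≤ trigPolys n := by
  apply Submodule.span_mono
  apply Set.image_mono
  exact_mod_cast Finset.Icc_subset_Icc (by simpa using h) (by simpa using h)

theorem cos_pow_mem_trigPolys (n : ℕ) : (fun y => (Real.cos y : ℂ) ^ n) ∈ trigPolys n := by
  induction n with
  | zero =>
    have : (fun y => (Real.cos y : ℂ) ^ 0) = expChar 0 := by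
      funext y
      simp [expChar_zero]
    rw [this]
    exact expChar_mem_trigPolys (by simp)
  | succ n ih => simpa only [pow_succ'] using cos_mul_mem_trigPolys ih

theorem eval_cos_mem_trigPolys {n : ℕ} {q : Polynomial ℝ} (hq : q.natDegree ≤ n) :
    (fun y => ((q.eval (Real.cos y) : ℝ) : ℂ)) ∈ trigPolys n := by
  have : (fun y => ((q.eval (Real.cos y) : ℝ) : ℂ)) =
      ∑ i ∈ Finset.range (n + 1), (q.coeff i : ℂ) • fun y => (Real.cos y : ℂ) ^ i := by
    funext y
    rw [Polynomial.eval_eq_sum_range' (Nat.lt_succ_of_le hq), Finset.sum_apply]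
    push_cast
    rfl
  rw [this]
  refine sum_mem fun i hi => Submodule.smul_mem _ _ (trigPolys_mono ?_ (cos_pow_mem_trigPolys i))
  exact Nat.lt_succ_iff.1 (Finset.mem_range.1 hi)

/-- The bump is a polynomial of degree at most `d` in `cos y`, because `T_d` is composed with an
affine map. -/
theorem bump_mem_trigPolys (d : ℕ) (δ : ℝ) : (fun y => (bump d δ y : ℂ)) ∈ trigPolys d := by
  let q : Polynomial ℝ := (Polynomial.Chebyshev.T ℝ (d : ℤ)).comp
    (Polynomial.C (2 / (1 + Real.cos δ)) * Polynomial.X +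
      Polynomial.C (1 - 2 * Real.cos δ / (1 + Real.cos δ)))
  have hq : q.natDegree ≤ d := by
    refine Polynomial.natDegree_comp_le.trans ?_
    have h1 : (Polynomial.Chebyshev.T ℝ (d : ℤ)).natDegree = d := by
      simp [Polynomial.Chebyshev.natDegree_T]
    rw [h1]
    exact (Nat.mul_le_mul_left d Polynomial.natDegree_linear_le).trans (by simp)
  have : (fun y => (bump d δ y : ℂ)) = fun y => ((q.eval (Real.cos y) : ℝ) : ℂ) := by
    funext y
    simp only [bump, q, Polynomial.eval_comp, Polynomial.eval_add, Polynomial.eval_mul,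
      Polynomial.eval_C, Polynomial.eval_X]
    congr 2
    ring
  rw [this]
  exact eval_cos_mem_trigPolys hq

theorem exists_mollifier_expansion (d : ℕ) (δ : ℝ) :
    ∃ c : ℤ → ℂ, ∀ y, (mollifier d δ y : ℂ) =
      ∑ j ∈ Finset.Icc (-(d : ℤ)) d, c j * expChar j y := by
  have h := Submodule.smul_mem _ ((bumpIntegral d δ : ℂ)⁻¹) (bump_mem_trigPolys d δ)
  obtain ⟨c, hc⟩ := (Submodule.mem_span_image_finset_iff_exists_fun ℂ).1 h
  refine ⟨fun j => if h : j ∈ Finset.Icc (-(d : ℤ)) d then c ⟨j, h⟩ else 0, fun y => ?_⟩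
  have := congrFun hc y
  simp only [Finset.sum_apply, Pi.smul_apply, smul_eq_mul] at this
  rw [← Finset.sum_coe_sort]
  simp only [Finset.coe_mem, dif_pos, Subtype.coe_eta]
  rw [this, mollifier_eq]
  push_cast
  ring

theorem integral_expChar (k : ℤ) :
    ∫ x in (-Real.pi)..Real.pi, expChar k x = if k = 0 then 2 * (Real.pi : ℂ) else 0 := by
  split_ifs with h
  · subst h
    simp only [expChar_zero, intervalIntegral.integral_const, Complex.real_smul]
    push_cast
    ring
  · have hk : Complex.I * k ≠ 0 := mul_ne_zero Complex.I_ne_zero (by exact_mod_cast h)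
    simp only [expChar]
    rw [integral_exp_mul_complex hk]
    have : Complex.exp (Complex.I * k * (Real.pi : ℂ)) =
        Complex.exp (Complex.I * k * ((-Real.pi : ℝ) : ℂ)) := by
      rw [Complex.exp_eq_exp_iff_exists_int]
      exact ⟨k, by push_cast; ring⟩
    rw [this]
    simp

theorem fourier_coeff_of_expansion {d : ℕ} {f : ℝ → ℂ} {c : ℤ → ℂ}
    (h : ∀ y, f y = ∑ j ∈ Finset.Icc (-(d : ℤ)) d, c j * expChar j y) {k : ℤ}
    (hk : k ∈ Finset.Icc (-(d : ℤ)) d) :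
    (1 / (2 * Real.pi) : ℂ) * ∫ x in (-Real.pi)..Real.pi, f x * expChar (-k) x = c k := by
  have e : ∀ x, f x * expChar (-k) x =
      ∑ j ∈ Finset.Icc (-(d : ℤ)) d, c j * expChar (j + -k) x := by
    intro x
    rw [h, Finset.sum_mul]
    refine Finset.sum_congr rfl fun j _ => ?_
    rw [expChar_add]
    ring
  simp only [e]
  rw [intervalIntegral.integral_finsetSum
    (f := fun j x => c j * expChar (j + -k) x)
    (fun j _ => (continuous_const.mul (continuous_expChar _)).intervalIntegrable _ _)]
  simp only [intervalIntegral.integral_const_mul, integral_expChar]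
  rw [Finset.sum_eq_single k]
  · simp only [add_neg_cancel, if_true]
    have : (Real.pi : ℂ) ≠ 0 := by exact_mod_cast Real.pi_ne_zero
    field_simp
  · intro j _ hj
    rw [if_neg, mul_zero]
    intro h
    exact hj (by linarith)
  · exact fun h => absurd hk h

theorem coeff_eq_expChar (d : ℕ) (δ : ℝ) (j : ℤ) :
    coeff d δ j = (1 / (2 * Real.pi) : ℂ) * ∫ x in (-Real.pi)..Real.pi,
      (approxHeaviside d δ x : ℂ) * expChar (-j) x := by
  rw [coeff]
  congr 2
  funext x
  rw [expChar]
  congr 2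
  push_cast
  ring

theorem approxHeaviside_expansion_aux {d : ℕ} {δ : ℝ} {c : ℤ → ℂ}
    (hc : ∀ y, (mollifier d δ y : ℂ) = ∑ j ∈ Finset.Icc (-(d : ℤ)) d, c j * expChar j y)
    (x : ℝ) :
    (approxHeaviside d δ x : ℂ) = ∑ j ∈ Finset.Icc (-(d : ℤ)) d,
      (c j * ∫ z in (0 : ℝ)..Real.pi, expChar (-j) z) * expChar j x := by
  rw [approxHeaviside_eq, ← intervalIntegral.integral_ofReal]
  simp only [hc, expChar_sub_arg]
  rw [intervalIntegral.integral_finsetSum]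
  · refine Finset.sum_congr rfl fun j _ => ?_
    simp only [intervalIntegral.integral_const_mul]
    ring
  · intro j _
    exact (continuous_const.mul
      (continuous_const.mul (continuous_expChar _))).intervalIntegrable _ _

/-- The convolution theorem: the coefficient factors into those of the mollifier and of the
Heaviside function, the latter supplying the `1/|j|` decay. -/
theorem coeff_eq {d : ℕ} (δ : ℝ) {j : ℤ} (hj : j ∈ Finset.Icc (-(d : ℤ)) d) :
    coeff d δ j = ((1 / (2 * Real.pi) : ℂ) * ∫ x in (-Real.pi)..Real.pi,
      (mollifier d δ x : ℂ) * expChar (-j) x) * ∫ z in (0 : ℝ)..Real.pi, expChar (-j) z := by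
  obtain ⟨c, hc⟩ := exists_mollifier_expansion d δ
  rw [coeff_eq_expChar, fourier_coeff_of_expansion (approxHeaviside_expansion_aux hc) hj,
    fourier_coeff_of_expansion hc hj]

theorem approxHeaviside_expansion (d : ℕ) (δ x : ℝ) :
    (approxHeaviside d δ x : ℂ) =
      ∑ j ∈ Finset.Icc (-(d : ℤ)) d, coeff d δ j * expChar j x := by
  obtain ⟨c, hc⟩ := exists_mollifier_expansion d δ
  rw [approxHeaviside_expansion_aux hc]
  refine Finset.sum_congr rfl fun j hj => ?_
  rw [coeff_eq_expChar, fourier_coeff_of_expansion (approxHeaviside_expansion_aux hc) hj]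

theorem coeff_zero {d : ℕ} {δ : ℝ} (hI : 0 < bumpIntegral d δ) : coeff d δ 0 = 1 / 2 := by
  rw [coeff_eq δ (by simp)]
  have h := integral_mollifier hI (-Real.pi)
  rw [show -Real.pi + 2 * Real.pi = Real.pi by ring] at h
  simp only [neg_zero, expChar_zero, mul_one]
  rw [intervalIntegral.integral_ofReal, h]
  have : (Real.pi : ℂ) ≠ 0 := by exact_mod_cast Real.pi_ne_zero
  simp
  field_simp

theorem norm_integral_expChar_le {j : ℤ} (hj : j ≠ 0) :
    ‖∫ z in (0 : ℝ)..Real.pi, expChar (-j) z‖ ≤ 2 / |(j : ℝ)| := by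
  have hk : Complex.I * ((-j : ℤ) : ℂ) ≠ 0 :=
    mul_ne_zero Complex.I_ne_zero (by exact_mod_cast neg_ne_zero.2 hj)
  have e : ∫ z in (0 : ℝ)..Real.pi, expChar (-j) z =
      (expChar (-j) Real.pi - expChar (-j) 0) / (Complex.I * ((-j : ℤ) : ℂ)) := by
    simp only [expChar]
    exact integral_exp_mul_complex hk
  rw [e, norm_div]
  have h1 : ‖Complex.I * ((-j : ℤ) : ℂ)‖ = |(j : ℝ)| := by simp
  rw [h1]
  refine div_le_div_of_nonneg_right ((norm_sub_le _ _).trans ?_) (abs_nonneg _)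
  rw [norm_expChar, norm_expChar]
  norm_num

theorem norm_coeff_le {d : ℕ} {δ : ℝ}
    (h2 : ∫ y in (-Real.pi)..Real.pi, |mollifier d δ y| ≤ 2) {j : ℤ}
    (hj : j ∈ Finset.Icc (-(d : ℤ)) d) (h0 : j ≠ 0) :
    ‖coeff d δ j‖ ≤ 1 / |(j : ℝ)| := by
  have hpi := Real.pi_gt_three
  rw [coeff_eq δ hj, norm_mul, norm_mul]
  have h1 : ‖∫ x in (-Real.pi)..Real.pi, (mollifier d δ x : ℂ) * expChar (-j) x‖ ≤ 2 := by
    refine (intervalIntegral.norm_integral_le_integral_norm (by linarith)).trans ?_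
    simpa only [norm_mul, norm_expChar, mul_one, Complex.norm_real, Real.norm_eq_abs] using h2
  have h3 : ‖(1 / (2 * Real.pi) : ℂ)‖ ≤ 1 / 6 := by
    have : (1 / (2 * Real.pi) : ℂ) = ((1 / (2 * Real.pi) : ℝ) : ℂ) := by push_cast; rfl
    rw [this, Complex.norm_real, Real.norm_eq_abs, abs_of_pos (by positivity)]
    exact div_le_div_of_nonneg_left (by norm_num) (by norm_num) (by linarith)
  -- The factors bound `1/(2π)`, the `L¹` norm of the mollifier, and the integral of the character
  -- over `[0, π]`.
  calc _ ≤ 1 / 6 * 2 * (2 / |(j : ℝ)|) := by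
        gcongr
        exact norm_integral_expChar_le h0
    _ ≤ 1 / |(j : ℝ)| := by
        have : 0 ≤ 1 / |(j : ℝ)| := by positivity
        calc _ = 2 / 3 * (1 / |(j : ℝ)|) := by ring
          _ ≤ _ := by linarith

theorem sum_Icc_neg_eq (f : ℤ → ℝ) (d : ℕ) :
    ∑ j ∈ Finset.Icc (-(d : ℤ)) d, f j =
      f 0 + ∑ i ∈ Finset.range d, (f (i + 1) + f (-(i + 1))) := by
  induction d with
  | zero => simp
  | succ n ih =>
    rw [Finset.sum_range_succ, ← add_assoc, ← ih]
    have : Finset.Icc (-((n + 1 : ℕ) : ℤ)) ((n + 1 : ℕ) : ℤ) =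
        insert ((n : ℤ) + 1) (insert (-((n : ℤ) + 1)) (Finset.Icc (-(n : ℤ)) n)) := by
      ext j
      simp only [Finset.mem_Icc, Finset.mem_insert]
      push_cast
      omega
    rw [this, Finset.sum_insert, Finset.sum_insert]
    · ring
    · simp
    · simp; omega

/-- The coefficient at `0` is `1/2`; the others are dominated by twice the harmonic sum, at most `2
(1 + log d)`. -/
theorem coeffNorm_le {d : ℕ} {δ : ℝ} (hI : 0 < bumpIntegral d δ)
    (h2 : ∫ y in (-Real.pi)..Real.pi, |mollifier d δ y| ≤ 2) :
    coeffNorm d δ ≤ 3 + 2 * Real.log d := by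
  rw [coeffNorm, sum_Icc_neg_eq (fun j => ‖coeff d δ j‖), coeff_zero hI]
  have h : ∑ i ∈ Finset.range d, (‖coeff d δ (i + 1)‖ + ‖coeff d δ (-(i + 1))‖) ≤
      ∑ i ∈ Finset.range d, 2 * ((i + 1 : ℝ))⁻¹ := by
    refine Finset.sum_le_sum fun i hi => ?_
    rw [Finset.mem_range] at hi
    have p := norm_coeff_le h2 (j := (i : ℤ) + 1)
      (by rw [Finset.mem_Icc]; constructor <;> omega) (by omega)
    have q := norm_coeff_le h2 (j := -((i : ℤ) + 1))
      (by rw [Finset.mem_Icc]; constructor <;> omega) (by omega)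
    have e : |(i : ℝ) + 1| = i + 1 := abs_of_pos (by positivity)
    push_cast at p q
    rw [abs_neg, e] at q
    rw [e] at p
    rw [one_div] at p q
    linarith
  rw [← Finset.mul_sum] at h
  have h3 := harmonic_le_one_add_log d
  have e : ((harmonic d : ℚ) : ℝ) = ∑ i ∈ Finset.range d, ((i + 1 : ℝ))⁻¹ := by
    rw [harmonic]
    push_cast
    rfl
  rw [e] at h3
  norm_num at h ⊢
  linarith

theorem coeffNorm_pos {d : ℕ} {δ : ℝ} (hI : 0 < bumpIntegral d δ) : 0 < coeffNorm d δ := by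
  refine Finset.sum_pos' (fun _ _ => norm_nonneg _) ⟨0, by simp, ?_⟩
  rw [coeff_zero hI]
  norm_num

end GroundEnergy

namespace GroundEnergy

/-! ### The Hadamard test -/

section Circuit

variable {ι : Type} [Fintype ι] [DecidableEq ι]

/-- The diagonal matrix `D` in the eigenbasis of a Hermitian matrix. -/
def eigenDiagonal {H : Matrix ι ι ℂ} (hH : H.IsHermitian) (D : ι → ℂ) : Matrix ι ι ℂ :=
  (hH.eigenvectorUnitary : Matrix ι ι ℂ) * Matrix.diagonal D *
    star (hH.eigenvectorUnitary : Matrix ι ι ℂ)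

/-- The weight of the state `ρ` on the `k`-th eigenvector of a Hermitian matrix. -/
def eigenWeight {H : Matrix ι ι ℂ} (hH : H.IsHermitian) (ρ : Matrix ι ι ℂ) (k : ι) : ℝ :=
  (((hH.eigenvectorUnitary : Matrix ι ι ℂ)ᴴ * ρ * (hH.eigenvectorUnitary : Matrix ι ι ℂ)) k k).re

variable {H ρ : Matrix ι ι ℂ} (hH : H.IsHermitian)

theorem eigenvectorUnitary_mul_star :
    (hH.eigenvectorUnitary : Matrix ι ι ℂ) * star (hH.eigenvectorUnitary : Matrix ι ι ℂ) = 1 :=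
  Unitary.coe_mul_star_self _

theorem star_mul_eigenvectorUnitary :
    star (hH.eigenvectorUnitary : Matrix ι ι ℂ) * (hH.eigenvectorUnitary : Matrix ι ι ℂ) = 1 :=
  Unitary.coe_star_mul_self _

theorem eq_eigenDiagonal : H = eigenDiagonal hH (fun k => (hH.eigenvalues k : ℂ)) := by
  conv_lhs => rw [hH.spectral_theorem]
  rw [Unitary.conjStarAlgAut_apply]
  rfl

theorem eigenDiagonal_one : eigenDiagonal hH (fun _ => 1) = 1 := by
  rw [eigenDiagonal, Matrix.diagonal_one, mul_one, eigenvectorUnitary_mul_star]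

theorem eigenDiagonal_mulVec (D : ι → ℂ) (k : ι) :
    eigenDiagonal hH D *ᵥ ⇑(hH.eigenvectorBasis k) = D k • ⇑(hH.eigenvectorBasis k) := by
  rw [eigenDiagonal, ← Matrix.mulVec_mulVec, hH.star_eigenvectorUnitary_mulVec,
    ← Matrix.mulVec_mulVec, ← hH.eigenvectorUnitary_mulVec, Matrix.diagonal_mulVec_single,
    ← Matrix.mulVec_smul]
  congr 1
  ext i
  simp [Pi.single_apply]

theorem eigenWeight_spec (hρ : ρ.PosSemidef) (k : ι) :
    0 ≤ eigenWeight hH ρ k ∧ ((hH.eigenvectorUnitary : Matrix ι ι ℂ)ᴴ * ρ *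
      (hH.eigenvectorUnitary : Matrix ι ι ℂ)) k k = (eigenWeight hH ρ k : ℂ) := by
  have h := (hρ.conjTranspose_mul_mul_same (hH.eigenvectorUnitary : Matrix ι ι ℂ)).diag_nonneg
    (i := k)
  rw [Complex.nonneg_iff] at h
  refine ⟨h.1, Complex.ext rfl ?_⟩
  rw [← h.2]
  simp

theorem trace_mul_eigenDiagonal (hρ : ρ.PosSemidef) (D : ι → ℂ) :
    (ρ * eigenDiagonal hH D).trace = ∑ k, (eigenWeight hH ρ k : ℂ) * D k := by
  rw [eigenDiagonal, ← mul_assoc, ← mul_assoc, Matrix.trace_mul_comm, ← mul_assoc, ← mul_assoc,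
    Matrix.trace]
  refine Finset.sum_congr rfl fun k _ => ?_
  rw [Matrix.diag_apply, Matrix.mul_diagonal, ← (eigenWeight_spec hH hρ k).2]
  rfl

theorem sum_eigenWeight (hρ : ρ.PosSemidef) (h1 : ρ.trace = 1) :
    ∑ k, eigenWeight hH ρ k = 1 := by
  have := trace_mul_eigenDiagonal hH hρ (fun _ => 1)
  rw [eigenDiagonal_one, mul_one, h1] at this
  simp only [mul_one] at this
  exact_mod_cast this.symm

theorem evolution_eq_eigenDiagonal (t : ℝ) :
    evolution H t =
      eigenDiagonal hH (fun k => Complex.exp (-(Complex.I * t * hH.eigenvalues k))) := by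
  have hinv : ((hH.eigenvectorUnitary : Matrix ι ι ℂ))⁻¹ =
      star (hH.eigenvectorUnitary : Matrix ι ι ℂ) :=
    Matrix.inv_eq_right_inv (eigenvectorUnitary_mul_star hH)
  have hu : IsUnit (hH.eigenvectorUnitary : Matrix ι ι ℂ) :=
    IsUnit.of_mul_eq_one _ (eigenvectorUnitary_mul_star hH)
  have e : (-(Complex.I * t)) • H = eigenDiagonal hH
      (fun k => -(Complex.I * t * hH.eigenvalues k)) := by
    conv_lhs => rw [eq_eigenDiagonal hH]
    rw [eigenDiagonal, eigenDiagonal, ← Matrix.smul_mul, ← Matrix.mul_smul,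
      ← Matrix.diagonal_smul]
    congr 3
    ext k
    simp [mul_assoc]
  rw [evolution, e, eigenDiagonal, ← hinv, Matrix.exp_conj _ _ hu, Matrix.exp_diagonal, hinv,
    eigenDiagonal]
  congr 3
  ext k
  rw [Pi.coe_exp, Complex.exp_eq_exp_ℂ]

theorem conjTranspose_evolution_mul (hH : H.IsHermitian) (t : ℝ) :
    (evolution H t)ᴴ * evolution H t = 1 := by
  rw [evolution_eq_eigenDiagonal hH, eigenDiagonal]
  simp only [Matrix.star_eq_conjTranspose, Matrix.conjTranspose_mul,
    Matrix.conjTranspose_conjTranspose, Matrix.diagonal_conjTranspose]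
  have h1 := star_mul_eigenvectorUnitary hH
  have h2 := eigenvectorUnitary_mul_star hH
  simp only [Matrix.star_eq_conjTranspose] at h1 h2
  simp only [Matrix.mul_assoc]
  rw [← Matrix.mul_assoc ((hH.eigenvectorUnitary : Matrix ι ι ℂ)ᴴ) (hH.eigenvectorUnitary : Matrix ι ι ℂ),
    h1, one_mul, ← Matrix.mul_assoc (Matrix.diagonal _) (Matrix.diagonal _), Matrix.diagonal_mul_diagonal]
  have : (fun k => star (fun k => Complex.exp (-(Complex.I * t * hH.eigenvalues k))) k *
      Complex.exp (-(Complex.I * t * hH.eigenvalues k))) = fun _ => 1 := by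
    funext k
    simp only [Pi.star_apply, Complex.star_def, ← Complex.exp_conj, ← Complex.exp_add]
    simp
  rw [this, Matrix.diagonal_one, one_mul, h2]

theorem toEuclideanLin_eigenvectorBasis (k : ι) :
    Matrix.toEuclideanLin H (hH.eigenvectorBasis k) =
      (hH.eigenvalues k : ℂ) • hH.eigenvectorBasis k := by
  rw [Matrix.toLpLin_apply, hH.mulVec_eigenvectorBasis]
  ext i
  simp

/-- Both operators are compared on the eigenbasis. An eigenvector for another eigenvalue is
orthogonal to the `μ`-eigenspace because `H` is symmetric. -/
theorem eigenProj_eq_eigenDiagonal (μ : ℝ) :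
    eigenProj H μ = eigenDiagonal hH (fun k => if hH.eigenvalues k = μ then 1 else 0) := by
  rw [eigenProj, StarAlgEquiv.symm_apply_eq]
  apply ContinuousLinearMap.coe_injective
  apply hH.eigenvectorBasis.toBasis.ext
  intro k
  rw [hH.eigenvectorBasis.coe_toBasis]
  have hR : Matrix.toEuclideanCLM (n := ι) (𝕜 := ℂ)
      (eigenDiagonal hH (fun k => if hH.eigenvalues k = μ then 1 else 0))
      (hH.eigenvectorBasis k) =
      (if hH.eigenvalues k = μ then (1 : ℂ) else 0) • hH.eigenvectorBasis k := by
    ext i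
    rw [Matrix.ofLp_toEuclideanCLM, eigenDiagonal_mulVec]
    rfl
  refine Eq.trans ?_ hR.symm
  change Submodule.starProjection _ _ = _
  split_ifs with h
  · rw [one_smul, Submodule.starProjection_eq_self_iff, Module.End.mem_eigenspace_iff,
      toEuclideanLin_eigenvectorBasis, h]
  · rw [zero_smul]
    rw [Submodule.starProjection_apply_eq_zero_iff, Submodule.mem_orthogonal]
    intro u hu
    rw [Module.End.mem_eigenspace_iff] at hu
    have hs := Matrix.isSymmetric_toEuclideanLin_iff.2 hH u (hH.eigenvectorBasis k)
    rw [hu, toEuclideanLin_eigenvectorBasis, inner_smul_left, inner_smul_right] at hs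
    simp only [Complex.conj_ofReal] at hs
    have : ((μ : ℂ) - hH.eigenvalues k) * inner ℂ u (hH.eigenvectorBasis k) = 0 := by
      rw [sub_mul, hs, sub_self]
    rcases mul_eq_zero.1 this with h' | h'
    · exact absurd (by exact_mod_cast (sub_eq_zero.1 h').symm) h
    · exact h'

theorem abs_eigenvalues_le_opNorm (k : ι) : |hH.eigenvalues k| ≤ opNorm H := by
  have h := (Matrix.toEuclideanCLM (n := ι) (𝕜 := ℂ) H).le_opNorm (hH.eigenvectorBasis k)
  have e : Matrix.toEuclideanCLM (n := ι) (𝕜 := ℂ) H (hH.eigenvectorBasis k) =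
      (hH.eigenvalues k : ℂ) • hH.eigenvectorBasis k := toEuclideanLin_eigenvectorBasis hH k
  rw [e, norm_smul, hH.eigenvectorBasis.orthonormal.1 k] at h
  simpa [opNorm] using h

/-- The signal of the Hadamard test. -/
theorem trace_mul_evolution (hρ : ρ.PosSemidef) (t : ℝ) :
    (ρ * evolution H t).trace = ∑ k, (eigenWeight hH ρ k : ℂ) *
      Complex.exp (-(Complex.I * t * hH.eigenvalues k)) := by
  rw [evolution_eq_eigenDiagonal hH, trace_mul_eigenDiagonal hH hρ]

theorem norm_trace_mul_evolution_le (hH : H.IsHermitian) (hρ : ρ.PosSemidef) (h1 : ρ.trace = 1)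
    (t : ℝ) : ‖(ρ * evolution H t).trace‖ ≤ 1 := by
  rw [trace_mul_evolution hH hρ, ← sum_eigenWeight hH hρ h1]
  refine (norm_sum_le _ _).trans (Finset.sum_le_sum fun k _ => ?_)
  have : ‖Complex.exp (-(Complex.I * t * hH.eigenvalues k))‖ = 1 := by
    rw [Complex.norm_exp]
    simp
  rw [norm_mul, this, mul_one, Complex.norm_real, Real.norm_eq_abs,
    abs_of_nonneg (eigenWeight_spec hH hρ k).1]

theorem trace_mul_eigenProj_re (hρ : ρ.PosSemidef) (μ : ℝ) :
    (ρ * eigenProj H μ).trace.re =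
      ∑ k, if hH.eigenvalues k = μ then eigenWeight hH ρ k else 0 := by
  rw [eigenProj_eq_eigenDiagonal hH, trace_mul_eigenDiagonal hH hρ, Complex.re_sum]
  refine Finset.sum_congr rfl fun k _ => ?_
  split_ifs <;> simp

/-- The two values of the control qubit give two branches, one acting by `1` and one by `U`; this
reduces the circuit to `2 × 2` amplitudes. -/
theorem circuit_eq (W : Matrix (Fin 2) (Fin 2) ℂ) (U : Matrix ι ι ℂ) :
    circuit W U = (hadamardGate * W * ancillaProj 0 * hadamardGate) ⊗ₖ (1 : Matrix ι ι ℂ) +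
      (hadamardGate * W * ancillaProj 1 * hadamardGate) ⊗ₖ U := by
  simp only [circuit, controlled, mul_add, add_mul, ← Matrix.mul_kronecker_mul, mul_one, one_mul]

theorem trace_ancillaProj_mul (b : Fin 2) (A B : Matrix (Fin 2) (Fin 2) ℂ) :
    (ancillaProj b * (A * ancillaProj 0 * Bᴴ)).trace = A b 0 * star (B b 0) := by
  fin_cases b <;>
  simp [ancillaProj, Matrix.trace_fin_two, Matrix.mul_apply, Matrix.single_apply]

theorem hadamardGate_mul_apply (w : ℂ) (b : Fin 2) :
    (hadamardGate * !![1, 0; 0, w] * ancillaProj 0 * hadamardGate) b 0 = 1 / 2 ∧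
    (hadamardGate * !![1, 0; 0, w] * ancillaProj 1 * hadamardGate) b 0 =
      outcomeValue b * w / 2 := by
  obtain ⟨r, h, hG⟩ : ∃ r : ℂ, r * r = 1 / 2 ∧ hadamardGate = !![r, r; r, -r] := by
    refine ⟨((1 / Real.sqrt 2 : ℝ) : ℂ), ?_, ?_⟩
    · rw [← Complex.ofReal_mul, div_mul_div_comm, Real.mul_self_sqrt (by norm_num)]
      norm_num
    · ext i j
      fin_cases i <;> fin_cases j <;> simp [hadamardGate]
  have p0 : ancillaProj 0 = !![1, 0; 0, 0] := by
    ext i j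
    fin_cases i <;> fin_cases j <;> simp [ancillaProj]
  have p1 : ancillaProj 1 = !![0, 0; 0, 1] := by
    ext i j
    fin_cases i <;> fin_cases j <;> simp [ancillaProj]
  rw [hG, p0, p1]
  fin_cases b
  · simp [outcomeValue]
    exact ⟨by linear_combination h, by linear_combination w * h⟩
  · simp [outcomeValue]
    exact ⟨by linear_combination h, by linear_combination (-w) * h⟩

/-- The two branches have amplitudes `1/2` and `±w/2`. The diagonal terms contribute `1/4` each, and
the interference terms add up to half the real part of `±w Tr[ρU]`. -/
theorem outcomeProb_diagonal {w : ℂ} (hw : ‖w‖ = 1) {U ρ : Matrix ι ι ℂ} (hU : Uᴴ * U = 1)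
    (hρ : ρ.IsHermitian) (h1 : ρ.trace = 1) (b : Fin 2) :
    outcomeProb !![1, 0; 0, w] U ρ b =
      (1 + (outcomeValue b * (w * (ρ * U).trace)).re) / 2 := by
  have t1 : (U * ρ * Uᴴ).trace = 1 := by
    rw [Matrix.trace_mul_comm, ← mul_assoc, hU, one_mul, h1]
  have t2 : (U * ρ).trace = (ρ * U).trace := Matrix.trace_mul_comm _ _
  have t3 : (ρ * Uᴴ).trace = star (ρ * U).trace := by
    rw [← Matrix.trace_conjTranspose, Matrix.conjTranspose_mul, hρ.eq, Matrix.trace_mul_comm]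
  obtain ⟨e0, e1⟩ := hadamardGate_mul_apply w b
  rw [outcomeProb, circuit_eq]
  simp only [Matrix.conjTranspose_add, Matrix.conjTranspose_kronecker, Matrix.add_mul,
    Matrix.mul_add, ← Matrix.mul_kronecker_mul, Matrix.trace_add, Matrix.trace_kronecker,
    trace_ancillaProj_mul, Matrix.conjTranspose_one, one_mul, mul_one, e0, e1, t1, t2, t3, h1]
  have hw2 : w * star w = 1 := by
    rw [Complex.star_def, Complex.mul_conj, Complex.normSq_eq_norm_sq, hw]
    simp
  have hv : outcomeValue b * star (outcomeValue b) = 1 := by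
    unfold outcomeValue; split_ifs <;> simp
  set v := outcomeValue b
  set z := (ρ * U).trace
  have e : (1 / 2 * star (1 / 2 : ℂ)) + v * w / 2 * star (1 / 2 : ℂ) * z +
      (1 / 2 * star (v * w / 2) * star z + v * w / 2 * star (v * w / 2)) =
      (2 + (v * (w * z) + star (v * (w * z)))) / 4 := by
    simp only [star_mul', star_div₀, star_one, star_ofNat]
    linear_combination (1 / 4) * star w * w * hv + (1 / 4) * hw2
  rw [e, Complex.star_def, Complex.add_conj]
  norm_cast
  ring

theorem outcomeProb_one {U ρ : Matrix ι ι ℂ} (hU : Uᴴ * U = 1)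
    (hρ : ρ.IsHermitian) (h1 : ρ.trace = 1) (b : Fin 2) :
    outcomeProb 1 U ρ b = (1 + (if b = 0 then 1 else -1) * (ρ * U).trace.re) / 2 := by
  have := outcomeProb_diagonal (w := 1) (by simp) hU hρ h1 b
  rw [← Matrix.one_fin_two] at this
  rw [this, outcomeValue]
  split_ifs <;> simp

theorem outcomeProb_phaseGate {U ρ : Matrix ι ι ℂ} (hU : Uᴴ * U = 1)
    (hρ : ρ.IsHermitian) (h1 : ρ.trace = 1) (b : Fin 2) :
    outcomeProb phaseGateᴴ U ρ b =
      (1 + (if b = 0 then 1 else -1) * (ρ * U).trace.im) / 2 := by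
  -- The factor `-i` from `S†` turns the real part of the trace into its imaginary part.
  have := outcomeProb_diagonal (w := -Complex.I) (by simp) hU hρ h1 b
  have e : phaseGateᴴ = !![1, 0; 0, -Complex.I] := by
    ext i j
    fin_cases i <;> fin_cases j <;> simp [phaseGate]
  rw [e, this, outcomeValue]
  split_ifs <;> simp

end Circuit

end GroundEnergy

namespace GroundEnergy

open MeasureTheory ProbabilityTheory

/-! ### Hoeffding's inequality for independent samples -/

/-- A variable with values in `[-K, K]` is, once centred, sub-Gaussian with variance proxy `K²`, and
the proxies add up over independent samples. -/
theorem hoeffding_pi {Ω : Type*} [MeasurableSpace Ω] (μ : Measure Ω) [IsProbabilityMeasure μ]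
    {f : Ω → ℝ} (hf : Measurable f) {K : ℝ} (hb : ∀ᵐ p ∂μ, |f p| ≤ K) (M : ℕ)
    {t : ℝ} (ht : 0 ≤ t) :
    (Measure.pi fun _ : Fin M => μ).real {w | t ≤ ∑ k, (f (w k) - ∫ p, f p ∂μ)} ≤
      Real.exp (-t ^ 2 / (2 * (M * K ^ 2))) := by
  have hind : iIndepFun (fun (k : Fin M) (w : Fin M → Ω) => f (w k) - ∫ p, f p ∂μ)
      (Measure.pi fun _ : Fin M => μ) :=
    iIndepFun_pi (X := fun _ p => f p - ∫ p, f p ∂μ) fun _ => (hf.sub_const _).aemeasurable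
  have hsub : ∀ k ∈ (Finset.univ : Finset (Fin M)),
      HasSubgaussianMGF (fun w : Fin M → Ω => f (w k) - ∫ p, f p ∂μ)
        ((‖K - -K‖₊ / 2) ^ 2) (Measure.pi fun _ : Fin M => μ) := by
    intro k _
    have hm : AEMeasurable (fun w : Fin M → Ω => f (w k)) (Measure.pi fun _ : Fin M => μ) :=
      (hf.comp (measurable_pi_apply k)).aemeasurable
    have hae : ∀ᵐ w ∂(Measure.pi fun _ : Fin M => μ), f (w k) ∈ Set.Icc (-K) K := by
      filter_upwards [(Measure.tendsto_eval_ae_ae (μ := fun _ : Fin M => μ)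
        (i := k)).eventually hb] with w hw
      exact abs_le.1 hw
    have h := hasSubgaussianMGF_of_mem_Icc hm hae
    have e : ∫ w, f (w k) ∂(Measure.pi fun _ : Fin M => μ) = ∫ p, f p ∂μ :=
      integral_comp_eval (μ := fun _ : Fin M => μ) (i := k) hf.aestronglyMeasurable
    rwa [e] at h
  refine (HasSubgaussianMGF.measure_sum_ge_le_of_iIndepFun hind hsub ht).trans (le_of_eq ?_)
  congr 2
  push_cast
  simp only [Finset.sum_const, Finset.card_univ, Fintype.card_fin, nsmul_eq_mul,
    sub_neg_eq_add, Real.norm_eq_abs, div_pow, sq_abs]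
  ring

theorem hoeffding_pi_abs {Ω : Type*} [MeasurableSpace Ω] (μ : Measure Ω) [IsProbabilityMeasure μ]
    {f : Ω → ℝ} (hf : Measurable f) {K : ℝ} (hb : ∀ᵐ p ∂μ, |f p| ≤ K) (M : ℕ)
    {t : ℝ} (ht : 0 ≤ t) :
    (Measure.pi fun _ : Fin M => μ).real {w | t ≤ |∑ k, f (w k) - M * ∫ p, f p ∂μ|} ≤
      2 * Real.exp (-t ^ 2 / (2 * (M * K ^ 2))) := by
  have h1 := hoeffding_pi μ hf hb M ht
  have h2 := hoeffding_pi μ (f := fun p => -f p) hf.neg (by simpa using hb) M ht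
  have hs : {w : Fin M → Ω | t ≤ |∑ k, f (w k) - M * ∫ p, f p ∂μ|} ⊆
      {w | t ≤ ∑ k, (f (w k) - ∫ p, f p ∂μ)} ∪ {w | t ≤ ∑ k, (-f (w k) - ∫ p, -f p ∂μ)} := by
    intro w hw
    have e1 : ∑ k, (f (w k) - ∫ p, f p ∂μ) = ∑ k, f (w k) - M * ∫ p, f p ∂μ := by
      simp [Finset.sum_sub_distrib]
    have e2 : ∑ k, (-f (w k) - ∫ p, -f p ∂μ) = -(∑ k, f (w k) - M * ∫ p, f p ∂μ) := by
      rw [← e1, ← Finset.sum_neg_distrib]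
      refine Finset.sum_congr rfl fun k _ => ?_
      rw [integral_neg]
      ring
    simp only [Set.mem_union, Set.mem_ofPred_eq, e1, e2]
    exact le_abs.1 hw
  refine (measureReal_mono hs).trans ((measureReal_union_le _ _).trans ?_)
  linarith

/-! ### The law of a sample -/

section

variable {ι : Type} [Fintype ι] [DecidableEq ι] {H ρ : Matrix ι ι ℂ}

/-- The probability of `(J, X, Y) = (j, ±1, ±1)`. -/
def sampleWeight (H ρ : Matrix ι ι ℂ) (τ : ℝ) (d : ℕ) (δ : ℝ) (j : ℤ) (a b : Fin 2) : ℝ :=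
  ‖coeff d δ j‖ / coeffNorm d δ * outcomeProb 1 (evolution H (j * τ)) ρ a
      * outcomeProb phaseGateᴴ (evolution H (j * τ)) ρ b

theorem sampleWeight_eq (hH : H.IsHermitian) (hρ : ρ.PosSemidef) (h1 : ρ.trace = 1) (τ : ℝ)
    (d : ℕ) (δ : ℝ) (j : ℤ) (a b : Fin 2) :
    sampleWeight H ρ τ d δ j a b = ‖coeff d δ j‖ / coeffNorm d δ *
      ((1 + (if a = 0 then 1 else -1) * (ρ * evolution H (j * τ)).trace.re) / 2) *
      ((1 + (if b = 0 then 1 else -1) * (ρ * evolution H (j * τ)).trace.im) / 2) := by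
  have hU := conjTranspose_evolution_mul hH (j * τ)
  rw [sampleWeight, outcomeProb_one hU hρ.1 h1, outcomeProb_phaseGate hU hρ.1 h1]

theorem coeffNorm_nonneg (d : ℕ) (δ : ℝ) : 0 ≤ coeffNorm d δ :=
  Finset.sum_nonneg fun _ _ => norm_nonneg _

theorem sampleWeight_nonneg (hH : H.IsHermitian) (hρ : ρ.PosSemidef) (h1 : ρ.trace = 1) (τ : ℝ)
    (d : ℕ) (δ : ℝ) (j : ℤ) (a b : Fin 2) : 0 ≤ sampleWeight H ρ τ d δ j a b := by
  rw [sampleWeight_eq hH hρ h1]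
  have hn := norm_trace_mul_evolution_le hH hρ h1 (j * τ)
  have hr := abs_le.1 ((Complex.abs_re_le_norm _).trans hn)
  have hi := abs_le.1 ((Complex.abs_im_le_norm _).trans hn)
  refine mul_nonneg (mul_nonneg (div_nonneg (norm_nonneg _) (coeffNorm_nonneg d δ)) ?_) ?_
  · split_ifs <;> linarith
  · split_ifs <;> linarith

theorem sampleLaw_eq (H ρ : Matrix ι ι ℂ) (τ : ℝ) (d : ℕ) (δ : ℝ) : sampleLaw H ρ τ d δ =
    ∑ q ∈ Finset.Icc (-(d : ℤ)) d ×ˢ (Finset.univ : Finset (Fin 2 × Fin 2)),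
      ENNReal.ofReal (sampleWeight H ρ τ d δ q.1 q.2.1 q.2.2) •
        Measure.dirac (q.1, outcomeValue q.2.1 + outcomeValue q.2.2 * Complex.I) := by
  rw [Finset.sum_product]
  simp only [Fintype.sum_prod_type]
  rfl

theorem sum_sampleWeight_mul (hH : H.IsHermitian) (hρ : ρ.PosSemidef) (h1 : ρ.trace = 1) (τ : ℝ)
    (d : ℕ) (δ : ℝ) (g : ℤ → Fin 2 → Fin 2 → ℝ) :
    ∑ q ∈ Finset.Icc (-(d : ℤ)) d ×ˢ (Finset.univ : Finset (Fin 2 × Fin 2)),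
      sampleWeight H ρ τ d δ q.1 q.2.1 q.2.2 * g q.1 q.2.1 q.2.2 =
    ∑ j ∈ Finset.Icc (-(d : ℤ)) d, ‖coeff d δ j‖ / coeffNorm d δ *
      ∑ a, ∑ b,
      ((1 + (if a = 0 then 1 else -1) * (ρ * evolution H (j * τ)).trace.re) / 2) *
      ((1 + (if b = 0 then 1 else -1) * (ρ * evolution H (j * τ)).trace.im) / 2) * g j a b := by
  rw [Finset.sum_product]
  simp only [Fintype.sum_prod_type, sampleWeight_eq hH hρ h1, Finset.mul_sum, mul_assoc]

theorem isProbabilityMeasure_sampleLaw (hH : H.IsHermitian) (hρ : ρ.PosSemidef)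
    (h1 : ρ.trace = 1) (τ : ℝ) {d : ℕ} {δ : ℝ} (hN : 0 < coeffNorm d δ) :
    IsProbabilityMeasure (sampleLaw H ρ τ d δ) := by
  constructor
  rw [sampleLaw_eq, Measure.finsetSum_apply]
  simp only [Measure.smul_apply, measure_univ, smul_eq_mul, mul_one]
  rw [← ENNReal.ofReal_sum_of_nonneg fun q _ => sampleWeight_nonneg hH hρ h1 _ _ _ _ _ _,
    ENNReal.ofReal_eq_one]
  have := sum_sampleWeight_mul hH hρ h1 τ d δ (fun _ _ _ => 1)
  simp only [mul_one] at this
  rw [this]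
  have e : ∀ j : ℤ, ∑ a : Fin 2, ∑ b : Fin 2,
      ((1 + (if a = 0 then 1 else -1) * (ρ * evolution H (j * τ)).trace.re) / 2) *
      ((1 + (if b = 0 then 1 else -1) * (ρ * evolution H (j * τ)).trace.im) / 2) = 1 := by
    intro j
    simp only [Fin.sum_univ_two, if_true, Fin.one_eq_zero_iff]
    norm_num
    ring
  simp only [e, mul_one]
  rw [← Finset.sum_div]
  exact div_self hN.ne'

theorem ae_sampleLaw (τ : ℝ) (d : ℕ) (δ : ℝ) :
    ∀ᵐ p ∂(sampleLaw H ρ τ d δ), |(p.1 : ℝ)| ≤ d ∧ |p.2.re| ≤ 1 ∧ |p.2.im| ≤ 1 := by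
  rw [sampleLaw_eq, ae_finsetSum_measure_iff]
  intro q hq
  apply Measure.ae_smul_measure
  rw [ae_dirac_eq]
  have hj := Finset.mem_Icc.1 (Finset.mem_product.1 hq).1
  refine ⟨?_, ?_, ?_⟩
  · rw [abs_le]
    exact ⟨by exact_mod_cast hj.1, by exact_mod_cast hj.2⟩
  · simp only [outcomeValue]
    split_ifs <;> simp
  · simp only [outcomeValue]
    split_ifs <;> simp

/-- The contribution of one sample to the estimate of the cumulative distribution at `x`. -/
def estimateTerm (d : ℕ) (δ x : ℝ) (p : ℤ × ℂ) : ℝ :=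
  Real.cos ((coeff d δ p.1).arg + p.1 * x) * p.2.re -
    Real.sin ((coeff d δ p.1).arg + p.1 * x) * p.2.im

theorem measurable_estimateTerm (d : ℕ) (δ x : ℝ) : Measurable (estimateTerm d δ x) := by
  have h : Measurable fun p : ℤ × ℂ => (coeff d δ p.1).arg + p.1 * x :=
    (Measurable.of_discrete (f := fun j : ℤ => (coeff d δ j).arg + j * x)).comp measurable_fst
  exact (((Real.measurable_cos.comp h).mul (Complex.measurable_re.comp measurable_snd))).sub
    ((Real.measurable_sin.comp h).mul (Complex.measurable_im.comp measurable_snd))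

theorem abs_estimateTerm_le (d : ℕ) (δ x : ℝ) {p : ℤ × ℂ} (hr : |p.2.re| ≤ 1)
    (hi : |p.2.im| ≤ 1) : |estimateTerm d δ x p| ≤ 2 := by
  unfold estimateTerm
  refine (abs_sub _ _).trans ?_
  rw [abs_mul, abs_mul]
  have := mul_le_one₀ (Real.abs_cos_le_one ((coeff d δ p.1).arg + p.1 * x)) (abs_nonneg _) hr
  have := mul_le_one₀ (Real.abs_sin_le_one ((coeff d δ p.1).arg + p.1 * x)) (abs_nonneg _) hi
  linarith

/-- `estimateTerm` is the real part of `e^{i(θ_j + jx)} Z`; importance sampling supplies the factor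
`|F̂_j|`. -/
theorem norm_coeff_mul_rotation (d : ℕ) (δ x : ℝ) (j : ℤ) (z : ℂ) :
    ‖coeff d δ j‖ * (Real.cos ((coeff d δ j).arg + j * x) * z.re -
      Real.sin ((coeff d δ j).arg + j * x) * z.im) = (coeff d δ j * expChar j x * z).re := by
  have e : coeff d δ j * expChar j x =
      ‖coeff d δ j‖ * Complex.exp (((coeff d δ j).arg + j * x : ℝ) * Complex.I) := by
    conv_lhs => rw [← Complex.norm_mul_exp_arg_mul_I (coeff d δ j)]
    rw [expChar, mul_assoc, ← Complex.exp_add]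
    congr 2
    push_cast
    ring
  rw [e, mul_assoc, Complex.re_ofReal_mul, Complex.mul_re, Complex.exp_ofReal_mul_I_re,
    Complex.exp_ofReal_mul_I_im]

/-- The smoothed cumulative distribution function of `ρ` with respect to `τH`. -/
def smoothedCDF (hH : H.IsHermitian) (ρ : Matrix ι ι ℂ) (τ : ℝ) (d : ℕ) (δ x : ℝ) : ℝ :=
  ∑ k, eigenWeight hH ρ k * approxHeaviside d δ (x - τ * hH.eigenvalues k)

/-- Averaging over the outcomes replaces `Z` by `Tr[ρ e^{-ijτH}] = ∑ w_k e^{-ijτλ_k}`. Exchanging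
the sums over `j` and `k` reassembles `F(x - τ λ_k)`. -/
theorem integral_estimateTerm (hH : H.IsHermitian) (hρ : ρ.PosSemidef)
    (h1 : ρ.trace = 1) (τ : ℝ) {d : ℕ} {δ : ℝ} (hN : 0 < coeffNorm d δ) (x : ℝ) :
    coeffNorm d δ * ∫ p, estimateTerm d δ x p ∂(sampleLaw H ρ τ d δ) =
      smoothedCDF hH ρ τ d δ x := by
  have hint : ∀ (c : ENNReal) (q : ℤ × ℂ), c ≠ ⊤ →
      Integrable (estimateTerm d δ x) (c • Measure.dirac q) := fun c q hc =>
    (integrable_dirac (by simp)).smul_measure hc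
  rw [sampleLaw_eq, integral_finsetSum_measure fun q _ => hint _ _ ENNReal.ofReal_ne_top]
  simp only [integral_smul_measure, integral_dirac,
    ENNReal.toReal_ofReal (sampleWeight_nonneg hH hρ h1 _ _ _ _ _ _), smul_eq_mul]
  rw [sum_sampleWeight_mul hH hρ h1 τ d δ (fun j a b =>
    estimateTerm d δ x (j, outcomeValue a + outcomeValue b * Complex.I))]
  have e : ∀ j : ℤ, ∑ a : Fin 2, ∑ b : Fin 2,
      ((1 + (if a = 0 then 1 else -1) * (ρ * evolution H (j * τ)).trace.re) / 2) *
      ((1 + (if b = 0 then 1 else -1) * (ρ * evolution H (j * τ)).trace.im) / 2) *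
      estimateTerm d δ x (j, outcomeValue a + outcomeValue b * Complex.I) =
      Real.cos ((coeff d δ j).arg + j * x) * (ρ * evolution H (j * τ)).trace.re -
      Real.sin ((coeff d δ j).arg + j * x) * (ρ * evolution H (j * τ)).trace.im := by
    intro j
    simp [Fin.sum_univ_two, estimateTerm, outcomeValue]
    ring
  simp only [e]
  have e2 : coeffNorm d δ * ∑ j ∈ Finset.Icc (-(d : ℤ)) d, ‖coeff d δ j‖ / coeffNorm d δ *
      (Real.cos ((coeff d δ j).arg + j * x) * (ρ * evolution H (j * τ)).trace.re -
      Real.sin ((coeff d δ j).arg + j * x) * (ρ * evolution H (j * τ)).trace.im) =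
      (∑ j ∈ Finset.Icc (-(d : ℤ)) d,
        coeff d δ j * expChar j x * (ρ * evolution H (j * τ)).trace).re := by
    rw [Finset.mul_sum, Complex.re_sum]
    refine Finset.sum_congr rfl fun j _ => ?_
    rw [← norm_coeff_mul_rotation]
    field_simp
  rw [e2]
  have e3 : ∑ j ∈ Finset.Icc (-(d : ℤ)) d,
      coeff d δ j * expChar j x * (ρ * evolution H (j * τ)).trace =
      ((smoothedCDF hH ρ τ d δ x : ℝ) : ℂ) := by
    simp only [trace_mul_evolution hH hρ, smoothedCDF, Finset.mul_sum]
    rw [Finset.sum_comm]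
    push_cast
    refine Finset.sum_congr rfl fun k _ => ?_
    rw [approxHeaviside_expansion, Finset.mul_sum]
    refine Finset.sum_congr rfl fun j _ => ?_
    rw [expChar_sub_arg]
    have : Complex.exp (-(Complex.I * (j * τ) * hH.eigenvalues k)) =
        expChar (-j) (τ * hH.eigenvalues k) := by
      rw [expChar]
      congr 1
      push_cast
      ring
    rw [this]
    ring
  rw [e3, Complex.ofReal_re]

/-- The estimate of the cumulative distribution function, from all samples, scaled by `M`. -/
def estimate (d : ℕ) (δ : ℝ) {M : ℕ} (w : Fin M → ℤ × ℂ) (x : ℝ) : ℝ :=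
  coeffNorm d δ * ∑ k, estimateTerm d δ x (w k)

/-- Hoeffding with `K = 2` and `t = Mη/(4𝓕)`: the exponent `t²/(8M)` equals `Mη²/(128𝓕²)`. -/
theorem estimate_deviation (hH : H.IsHermitian) (hρ : ρ.PosSemidef)
    (h1 : ρ.trace = 1) (τ : ℝ) {d : ℕ} {δ : ℝ} (hN : 0 < coeffNorm d δ) (M : ℕ) (x : ℝ)
    {η : ℝ} (hη : 0 ≤ η) :
    (samplesLaw H ρ τ d δ M).real
      {w | M * (η / 4) ≤ |estimate d δ w x - M * smoothedCDF hH ρ τ d δ x|} ≤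
      2 * Real.exp (-(M * η ^ 2 / (128 * coeffNorm d δ ^ 2))) := by
  have := isProbabilityMeasure_sampleLaw hH hρ h1 τ hN
  have hb : ∀ᵐ p ∂(sampleLaw H ρ τ d δ), |estimateTerm d δ x p| ≤ 2 := by
    filter_upwards [ae_sampleLaw (H := H) (ρ := ρ) τ d δ] with p hp
    exact abs_estimateTerm_le d δ x hp.2.1 hp.2.2
  have h := hoeffding_pi_abs (sampleLaw H ρ τ d δ) (measurable_estimateTerm d δ x) hb M
    (t := M * (η / 4) / coeffNorm d δ) (by positivity)
  have es : {w : Fin M → ℤ × ℂ | M * (η / 4) / coeffNorm d δ ≤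
      |∑ k, estimateTerm d δ x (w k) - M * ∫ p, estimateTerm d δ x p ∂(sampleLaw H ρ τ d δ)|} =
      {w | M * (η / 4) ≤ |estimate d δ w x - M * smoothedCDF hH ρ τ d δ x|} := by
    ext w
    simp only [Set.mem_ofPred_eq]
    rw [estimate, ← integral_estimateTerm hH hρ h1 τ hN, mul_left_comm (M : ℝ), ← mul_sub, abs_mul,
      abs_of_pos hN, div_le_iff₀' hN]
  rw [es] at h
  refine h.trans (le_of_eq ?_)
  congr 2
  -- For `M = 0` both exponents vanish, one of them because division by zero gives zero.
  rcases Nat.eq_zero_or_pos M with rfl | hM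
  · simp
  · have : (0 : ℝ) < M := by exact_mod_cast hM
    field_simp
    ring

/-! ### Detection of the lowest eigenvalue -/

theorem smoothedCDF_le (hH : H.IsHermitian) (hρ : ρ.PosSemidef) (h1 : ρ.trace = 1) {τ : ℝ}
    {d : ℕ} {δ : ℝ} (h0 : 0 ≤ δ) (hδ : 0 < 1 + Real.cos δ) (hI : 0 < bumpIntegral d δ) {E₀ x : ℝ}
    (hE : ∀ k, E₀ ≤ hH.eigenvalues k) (hτ : 0 ≤ τ) (hx : x ≤ τ * E₀ - δ)
    (hlow : ∀ k, -Real.pi + δ ≤ x - τ * hH.eigenvalues k) :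
    smoothedCDF hH ρ τ d δ x ≤ Real.pi / bumpIntegral d δ := by
  rw [← one_mul (Real.pi / _), ← sum_eigenWeight hH hρ h1, Finset.sum_mul]
  refine Finset.sum_le_sum fun k _ => mul_le_mul_of_nonneg_left ?_ (eigenWeight_spec hH hρ k).1
  have := mul_le_mul_of_nonneg_left (hE k) hτ
  exact (le_abs_self _).trans (abs_approxHeaviside_le hδ hI h0 (hlow k) (by linarith))

/-- Only the ground eigenvectors need `F` close to `1`; for all others the global lower bound on `F`
suffices. -/
theorem le_smoothedCDF (hH : H.IsHermitian) (hρ : ρ.PosSemidef) (h1 : ρ.trace = 1) {τ : ℝ}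
    {d : ℕ} {δ : ℝ} (h0 : 0 ≤ δ) (hδ : 0 < 1 + Real.cos δ) (hI : 0 < bumpIntegral d δ) {E₀ x : ℝ}
    (hx : τ * E₀ + δ ≤ x) (hup : x - τ * E₀ ≤ Real.pi - δ) :
    (ρ * eigenProj H E₀).trace.re - Real.pi / bumpIntegral d δ ≤ smoothedCDF hH ρ τ d δ x := by
  rw [trace_mul_eigenProj_re hH hρ, ← one_mul (Real.pi / _), ← sum_eigenWeight hH hρ h1,
    Finset.sum_mul, ← Finset.sum_sub_distrib]
  refine Finset.sum_le_sum fun k _ => ?_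
  have hw := (eigenWeight_spec hH hρ k).1
  split_ifs with h
  · rw [h]
    have := one_sub_le_approxHeaviside hδ hI h0 (x := x - τ * E₀) (by linarith) hup
    nlinarith
  · have := neg_le_approxHeaviside hδ hI (x - τ * hH.eigenvalues k)
    nlinarith

end

end GroundEnergy

namespace GroundEnergy

/-! ### The post-processing program -/

/-- A nonempty straight-line program. -/
def straightLine : Op → List Op → Prog
  | o, [] => .op o
  | o, o' :: l => .seq (.op o) (straightLine o' l)

theorem exec_straightLine (A : ℕ → ℤ → ℝ) (o : Op) (l : List Op) (s : ℕ → ℝ) :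
    Exec A (straightLine o l) s ((o :: l).foldl (Op.apply A) s) (l.length + 1) := by
  induction l generalizing o s with
  | nil => exact Exec.op o s
  | cons o' l ih =>
    have := Exec.seq (Exec.op o s) (ih o' (o.apply A s))
    rwa [add_comm 1] at this

/-- Adds the contribution of the sample with index `s 16` to the register `15`. -/
def termBlock : Prog :=
  straightLine (.read 17 0 16) [.read 18 3 17, .mul 19 17 14, .add 18 18 19, .cos 19 18,
    .sin 20 18, .read 21 1 16, .read 22 2 16, .mul 19 19 21, .mul 20 20 22, .sub 19 19 20,
    .add 15 15 19, .add 16 16 10]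

/-- Adds up the contributions of all samples. -/
def sumLoop : Prog := .whileLt 16 5 termBlock

/-- One bisection step of the interval `[s 7, s 8]`. -/
def bisectBlock : Prog :=
  .seq (straightLine (.add 14 7 8) [.mul 14 14 11, .const 15 0, .const 16 0])
    (.seq sumLoop (.seq (.op (.mul 15 15 6))
      -- Register `23` always holds `0`, so these additions copy the midpoint into an endpoint.
      -- Register `12` holds the threshold `ηM/2`.
      (.seq (.ifLt 12 15 (.op (.add 8 14 23)) (.op (.add 7 14 23))) (.op (.sub 13 8 7)))))

/-- The bisection, down to an interval of length at most `s 9`. -/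
def bisectLoop : Prog := .whileLt 9 13 bisectBlock

/-- The post-processing: bisection for the jump of the estimated cumulative distribution function
on `[-3/2, 3/2]` with resolution `2/3 τε` and threshold `η/2`. -/
def groundEnergyProg : Prog :=
  .seq (straightLine (.const 7 (-3 / 2)) [.const 8 (3 / 2), .const 9 (2 / 3), .mul 9 9 1,
    .mul 9 9 0, .const 10 1, .const 11 (1 / 2), .mul 12 2 11, .mul 12 12 5, .sub 13 8 7])
    (.seq bisectLoop (straightLine (.add 14 7 8) [.mul 14 14 11, .div 0 14 1]))

/-- The contribution of the sample `k`, as read off the input arrays. -/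
def arrayTerm (A : ℕ → ℤ → ℝ) (x : ℝ) (k : ℕ) : ℝ :=
  Real.cos (lookup (A 3) (lookup (A 0) k) + lookup (A 0) k * x) * lookup (A 1) k -
    Real.sin (lookup (A 3) (lookup (A 0) k) + lookup (A 0) k * x) * lookup (A 2) k

theorem exec_termBlock (A : ℕ → ℤ → ℝ) (s : ℕ → ℝ) (k : ℕ) (hk : s 16 = k) (h10 : s 10 = 1) :
    ∃ s', Exec A termBlock s s' 13 ∧ s' 15 = s 15 + arrayTerm A (s 14) k ∧
      s' 16 = (k + 1 : ℕ) ∧ ∀ i, i < 15 ∨ 22 < i → s' i = s i := by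
  refine ⟨_, exec_straightLine _ _ _ _, ?_, ?_, fun i hi => ?_⟩
  · simp [Op.apply, arrayTerm, hk]
  · simp [Op.apply, hk, h10]
  · have : i ≠ 15 ∧ i ≠ 16 ∧ i ≠ 17 ∧ i ≠ 18 ∧ i ≠ 19 ∧ i ≠ 20 ∧ i ≠ 21 ∧ i ≠ 22 := by omega
    simp [Op.apply, this]

theorem exec_sumLoop (A : ℕ → ℤ → ℝ) (n k : ℕ) (s : ℕ → ℝ) (hk : s 16 = k)
    (hn : s 5 = (k + n : ℕ)) (h10 : s 10 = 1) :
    ∃ s', Exec A sumLoop s s' (14 * n + 1) ∧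
      s' 15 = s 15 + ∑ i ∈ Finset.range n, arrayTerm A (s 14) (k + i) ∧
      ∀ i, i < 15 ∨ 22 < i → s' i = s i := by
  induction n generalizing k s with
  | zero =>
    refine ⟨s, Exec.while_false ?_, by simp, fun _ _ => rfl⟩
    rw [hk, hn]
    simp
  | succ n ih =>
    obtain ⟨s₁, he, h15, h16, hf⟩ := exec_termBlock A s k hk h10
    obtain ⟨s₂, he', h15', hf'⟩ := ih (k + 1) s₁ h16
      (by rw [hf 5 (by omega), hn]; push_cast; ring) (by rw [hf 10 (by omega), h10])
    refine ⟨s₂, ?_, ?_, fun i hi => (hf' i hi).trans (hf i hi)⟩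
    · have hlt : s 16 < s 5 := by
        rw [hk, hn]
        exact_mod_cast Nat.lt_add_of_pos_right (Nat.succ_pos n)
      have := Exec.while_true hlt he he'
      rwa [show 13 + (14 * n + 1) + 1 = 14 * (n + 1) + 1 by ring] at this
    · rw [h15', h15, hf 14 (by omega), Finset.sum_range_succ', add_assoc]
      congr 1
      rw [add_comm]
      congr 1
      refine Finset.sum_congr rfl fun i _ => ?_
      rw [add_assoc, add_comm 1 i]

open Classical in
/-- The half of the interval `p` selected by the decision at its midpoint. -/
def bisectStep (dec : ℝ → Prop) (p : ℝ × ℝ) : ℝ × ℝ :=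
  if dec ((p.1 + p.2) * (1 / 2)) then (p.1, (p.1 + p.2) * (1 / 2))
  else ((p.1 + p.2) * (1 / 2), p.2)

theorem bisectStep_length (dec : ℝ → Prop) (p : ℝ × ℝ) :
    (bisectStep dec p).2 - (bisectStep dec p).1 = (p.2 - p.1) / 2 := by
  unfold bisectStep
  split_ifs <;> dsimp only <;> ring

/-- The decision of the program at `x`. -/
def arrayDecision (A : ℕ → ℤ → ℝ) (s : ℕ → ℝ) (M : ℕ) (x : ℝ) : Prop :=
  s 12 < (∑ i ∈ Finset.range M, arrayTerm A x i) * s 6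

theorem exec_bisectBlock (A : ℕ → ℤ → ℝ) (M : ℕ) (s : ℕ → ℝ) (h5 : s 5 = M) (h10 : s 10 = 1)
    (h11 : s 11 = 1 / 2) (h23 : s 23 = 0) :
    ∃ s', Exec A bisectBlock s s' (14 * M + 9) ∧
      (s' 7, s' 8) = bisectStep (arrayDecision A s M) (s 7, s 8) ∧ s' 13 = s' 8 - s' 7 ∧
      ∀ i, i < 7 ∨ 8 < i ∧ i < 13 ∨ 22 < i → s' i = s i := by
  have he := exec_straightLine A (.add 14 7 8) [.mul 14 14 11, .const 15 0, .const 16 0] s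
  obtain ⟨s₁, hs₁⟩ : ∃ s₁, s₁ = (Op.add 14 7 8 ::
    [Op.mul 14 14 11, Op.const 15 0, Op.const 16 0]).foldl (Op.apply A) s := ⟨_, rfl⟩
  rw [← hs₁] at he
  have h14 : s₁ 14 = (s 7 + s 8) * (1 / 2) := by simp [hs₁, Op.apply, h11]
  have h15 : s₁ 15 = 0 := by simp [hs₁, Op.apply]
  have h16 : s₁ 16 = (0 : ℕ) := by simp [hs₁, Op.apply]
  have hf : ∀ i, i < 14 ∨ 22 < i → s₁ i = s i := by
    intro i hi
    have : i ≠ 14 ∧ i ≠ 15 ∧ i ≠ 16 := by omega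
    simp [hs₁, Op.apply, this]
  obtain ⟨s₂, he₂, hsum, hf₂⟩ := exec_sumLoop A M 0 s₁ h16
    (by rw [hf 5 (by omega), h5, zero_add]) (by rw [hf 10 (by omega), h10])
  rw [h14, h15, zero_add] at hsum
  simp only [zero_add] at hsum
  have he₃ := Exec.op (A := A) (.mul 15 15 6) s₂
  obtain ⟨s₃, hs₃⟩ : ∃ s₃, s₃ = Op.apply A s₂ (.mul 15 15 6) := ⟨_, rfl⟩
  rw [← hs₃] at he₃
  have h15₃ : s₃ 15 = (∑ i ∈ Finset.range M, arrayTerm A ((s 7 + s 8) * (1 / 2)) i) * s 6 := by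
    simp [hs₃, Op.apply, hsum, hf₂ 6, hf 6]
  have hf₃ : ∀ i, i < 14 ∨ 22 < i → s₃ i = s i := by
    intro i hi
    have : i ≠ 15 := by omega
    simp only [hs₃, Op.apply, Function.update_apply, this, if_false]
    rw [hf₂ i (by omega), hf i hi]
  have h14₃ : s₃ 14 = (s 7 + s 8) * (1 / 2) := by
    simp [hs₃, Op.apply, hf₂ 14, h14]
  by_cases hd : s₃ 12 < s₃ 15
  · have he₄ := Exec.if_true (q := .op (.add 7 14 23)) hd (Exec.op (A := A) (.add 8 14 23) s₃)
    have he₅ := Exec.seq he (Exec.seq he₂ (Exec.seq he₃ (Exec.seq he₄ (Exec.op (.sub 13 8 7) _))))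
    rw [show [Op.mul 14 14 11, Op.const 15 0, Op.const 16 0].length + 1 +
      (14 * M + 1 + (1 + (1 + 1 + 1))) = 14 * M + 9 by simp; ring] at he₅
    refine ⟨_, he₅, ?_, ?_, ?_⟩
    · have hdec : arrayDecision A s M ((s 7 + s 8) * (1 / 2)) := by
        rw [arrayDecision, ← h15₃, ← hf₃ 12 (by omega)]
        exact hd
      simp [bisectStep, Op.apply, -one_div, hdec, h14₃, hf₃ 7, hf₃ 23, h23]
    · simp [Op.apply]
    · intro i hi
      have : i ≠ 8 ∧ i ≠ 13 := by omega
      simp only [Op.apply, Function.update_apply, this, if_false]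
      exact hf₃ i (by omega)
  · have he₄ := Exec.if_false (p := .op (.add 8 14 23)) hd (Exec.op (A := A) (.add 7 14 23) s₃)
    have he₅ := Exec.seq he (Exec.seq he₂ (Exec.seq he₃ (Exec.seq he₄ (Exec.op (.sub 13 8 7) _))))
    rw [show [Op.mul 14 14 11, Op.const 15 0, Op.const 16 0].length + 1 +
      (14 * M + 1 + (1 + (1 + 1 + 1))) = 14 * M + 9 by simp; ring] at he₅
    refine ⟨_, he₅, ?_, ?_, ?_⟩
    · have hdec : ¬ arrayDecision A s M ((s 7 + s 8) * (1 / 2)) := by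
        rw [arrayDecision, ← h15₃, ← hf₃ 12 (by omega)]
        exact hd
      simp [bisectStep, Op.apply, -one_div, hdec, h14₃, hf₃ 8, hf₃ 23, h23]
    · simp [Op.apply]
    · intro i hi
      have : i ≠ 7 ∧ i ≠ 13 := by omega
      simp only [Op.apply, Function.update_apply, this, if_false]
      exact hf₃ i (by omega)

/-- The length halves whatever the decisions are, so the number of rounds does not depend on the
samples. This gives the cost bound for all sample values. -/
theorem exec_bisectLoop (A : ℕ → ℤ → ℝ) (M n : ℕ) (s : ℕ → ℝ) (h5 : s 5 = M) (h10 : s 10 = 1)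
    (h11 : s 11 = 1 / 2) (h23 : s 23 = 0) (h13 : s 13 = s 8 - s 7)
    (hfine : (s 8 - s 7) / 2 ^ n ≤ s 9) (hgo : ∀ l < n, s 9 < (s 8 - s 7) / 2 ^ l) :
    ∃ s', Exec A bisectLoop s s' (n * (14 * M + 10) + 1) ∧
      (s' 7, s' 8) = (bisectStep (arrayDecision A s M))^[n] (s 7, s 8) ∧
      ∀ i, i < 7 ∨ 8 < i ∧ i < 13 ∨ 22 < i → s' i = s i := by
  induction n generalizing s with
  | zero =>
    have h : ¬ s 9 < s 13 := by
      rw [h13]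
      simpa using hfine
    exact ⟨s, by simpa [bisectLoop] using Exec.while_false (A := A) (p := bisectBlock) h, rfl,
      fun _ _ => rfl⟩
  | succ n ih =>
    obtain ⟨s₁, he, hp, h13', hf⟩ := exec_bisectBlock A M s h5 h10 h11 h23
    have hlen : s₁ 8 - s₁ 7 = (s 8 - s 7) / 2 := by
      have := bisectStep_length (arrayDecision A s M) (s 7, s 8)
      rwa [← hp] at this
    have hdec : arrayDecision A s₁ M = arrayDecision A s M := by
      funext x
      rw [arrayDecision, arrayDecision, hf 12 (by omega), hf 6 (by omega)]
    obtain ⟨s₂, he', hp', hf'⟩ := ih s₁ (by rw [hf 5 (by omega), h5])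
      (by rw [hf 10 (by omega), h10]) (by rw [hf 11 (by omega), h11])
      (by rw [hf 23 (by omega), h23]) h13'
      (by rw [hf 9 (by omega), hlen, div_div, ← pow_succ']; exact hfine)
      (fun l hl => by
        rw [hf 9 (by omega), hlen, div_div, ← pow_succ']
        exact hgo (l + 1) (by omega))
    refine ⟨s₂, ?_, ?_, fun i hi => (hf' i hi).trans (hf i hi)⟩
    · have hlt : s 9 < s 13 := by
        rw [h13]
        simpa using hgo 0 (Nat.succ_pos n)
      have := Exec.while_true hlt he he'
      rwa [show 14 * M + 9 + (n * (14 * M + 10) + 1) + 1 = (n + 1) * (14 * M + 10) + 1 by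
        ring] at this
    · rw [hp', hdec, hp, Function.iterate_succ_apply]

theorem exec_groundEnergyProg (A : ℕ → ℤ → ℝ) (ε τ η ϑ : ℝ) (d : ℕ) (δ : ℝ) (M L : ℕ)
    (hδ : δ = 2 / 3 * (τ * ε)) (hfine : 3 / 2 ^ L ≤ δ) (hgo : ∀ l < L, δ < 3 / 2 ^ l) :
    ∃ s, Exec A groundEnergyProg (initRegs ε τ η ϑ d δ M) s (L * (14 * M + 10) + 14) ∧
      ∀ p, p = (bisectStep fun x => η * (1 / 2) * M <
          (∑ i ∈ Finset.range M, arrayTerm A x i) * coeffNorm d δ)^[L] (-3 / 2, 3 / 2) →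
        s 0 = (p.1 + p.2) * (1 / 2) / τ := by
  have he := exec_straightLine A (.const 7 (-3 / 2)) [.const 8 (3 / 2), .const 9 (2 / 3),
    .mul 9 9 1, .mul 9 9 0, .const 10 1, .const 11 (1 / 2), .mul 12 2 11, .mul 12 12 5,
    .sub 13 8 7] (initRegs ε τ η ϑ d δ M)
  obtain ⟨s₁, hs₁⟩ : ∃ s₁, s₁ = (Op.const 7 (-3 / 2) :: [.const 8 (3 / 2), .const 9 (2 / 3),
    .mul 9 9 1, .mul 9 9 0, .const 10 1, .const 11 (1 / 2), .mul 12 2 11, .mul 12 12 5,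
    .sub 13 8 7]).foldl (Op.apply A) (initRegs ε τ η ϑ d δ M) := ⟨_, rfl⟩
  rw [← hs₁] at he
  have h1 : s₁ 1 = τ := by simp [hs₁, Op.apply, initRegs]
  have h5 : s₁ 5 = M := by simp [hs₁, Op.apply, initRegs]
  have h6 : s₁ 6 = coeffNorm d δ := by simp [hs₁, Op.apply, initRegs]
  have h7 : s₁ 7 = -3 / 2 := by simp [hs₁, Op.apply]
  have h8 : s₁ 8 = 3 / 2 := by simp [hs₁, Op.apply]
  have h9 : s₁ 9 = δ := by simp [hs₁, Op.apply, initRegs, hδ]; ring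
  have h10 : s₁ 10 = 1 := by simp [hs₁, Op.apply]
  have h11 : s₁ 11 = 1 / 2 := by simp [hs₁, Op.apply]
  have h12 : s₁ 12 = η * (1 / 2) * M := by simp [hs₁, Op.apply, initRegs]
  have h13 : s₁ 13 = s₁ 8 - s₁ 7 := by simp [hs₁, Op.apply]
  have h23 : s₁ 23 = 0 := by simp [hs₁, Op.apply, initRegs]
  have hlen : s₁ 8 - s₁ 7 = 3 := by rw [h7, h8]; norm_num
  obtain ⟨s₂, he₂, hp, hf⟩ := exec_bisectLoop A M L s₁ h5 h10 h11 h23 h13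
    (by rw [hlen, h9]; exact hfine) (by rw [hlen, h9]; exact hgo)
  have hdec : arrayDecision A s₁ M = fun x => η * (1 / 2) * M <
      (∑ i ∈ Finset.range M, arrayTerm A x i) * coeffNorm d δ := by
    funext x
    rw [arrayDecision, h12, h6]
  have he₃ := exec_straightLine A (.add 14 7 8) [.mul 14 14 11, .div 0 14 1] s₂
  have he₄ := Exec.seq he (Exec.seq he₂ he₃)
  rw [show [Op.const 8 (3 / 2), .const 9 (2 / 3), .mul 9 9 1, .mul 9 9 0, .const 10 1,
    .const 11 (1 / 2), .mul 12 2 11, .mul 12 12 5, .sub 13 8 7].length + 1 +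
    (L * (14 * M + 10) + 1 + ([Op.mul 14 14 11, .div 0 14 1].length + 1)) =
    L * (14 * M + 10) + 14 by simp; ring] at he₄
  refine ⟨_, he₄, ?_⟩
  intro p hpp
  rw [hdec, h7, h8, ← hpp] at hp
  rw [← hp]
  simp [Op.apply, hf 11, h11, hf 1, h1]

/-! ### Correctness of the bisection -/

/-- The invariant is that the current interval meets `[e - δ, e + δ]`. At the end its length is at
most `δ`, so its midpoint is within `δ/2 + δ` of `e`. -/
theorem abs_bisect_sub_le {dec : ℝ → Prop} {e δ : ℝ} {L : ℕ} (h0 : 0 ≤ δ)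
    (hfine : 3 / 2 ^ L ≤ δ) (hgo : ∀ l < L, δ < 3 / 2 ^ l) (he : |e| ≤ 3 / 2)
    (hdec : ∀ l < L, ∀ i : ℕ, i < 2 ^ l → ∀ x : ℝ, x = -3 / 2 + (i + 1 / 2) * (3 / 2 ^ l) →
      |x - e| ≤ 3 / 2 * (3 / 2 ^ l) → (e + δ < x → dec x) ∧ (x < e - δ → ¬ dec x)) {p : ℝ × ℝ}
    (hp : p = (bisectStep dec)^[L] (-3 / 2, 3 / 2)) :
    |(p.1 + p.2) * (1 / 2) - e| ≤ 3 / 2 * δ := by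
  have key : ∀ l ≤ L, ∀ p, p = (bisectStep dec)^[l] (-3 / 2, 3 / 2) →
      ∃ i : ℕ, i < 2 ^ l ∧ p.1 = -3 / 2 + i * (3 / 2 ^ l) ∧ p.2 = p.1 + 3 / 2 ^ l ∧
        p.1 ≤ e + δ ∧ e - δ ≤ p.2 := by
    intro l
    induction l with
    | zero =>
      rintro - p rfl
      have := abs_le.1 he
      refine ⟨0, by simp, by simp, by simp; norm_num, ?_, ?_⟩ <;> simp <;> linarith
    | succ l ih =>
      rintro hl p rfl
      rw [Function.iterate_succ_apply']
      obtain ⟨i, hi, h1, h2, h3, h4⟩ := ih (by omega) _ rfl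
      set q := (bisectStep dec)^[l] (-3 / 2, 3 / 2)
      have hlen : (3 : ℝ) / 2 ^ l = 2 * (3 / 2 ^ (l + 1)) := by
        rw [pow_succ]
        field_simp
      have hmid : (q.1 + q.2) * (1 / 2) = -3 / 2 + (i + 1 / 2) * (3 / 2 ^ l) := by
        rw [h2, h1]
        ring
      have hg := hgo l (by omega)
      -- An interval of length `3/2^l` meeting `[e - δ, e + δ]` has its midpoint within half its
      -- length plus `δ` of `e`, and `δ < 3/2^l`.
      have hd := hdec l (by omega) i hi _ hmid (by rw [abs_le]; constructor <;> linarith)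
      have hpow : 2 ^ (l + 1) = 2 ^ l * 2 := pow_succ 2 l
      unfold bisectStep
      split_ifs with hc
      · refine ⟨2 * i, by omega, ?_, ?_, h3, ?_⟩
        · push_cast
          rw [h1, hlen]
          ring
        · simp only
          linarith
        · by_contra hlt
          exact hd.2 (not_le.1 hlt) hc
      · refine ⟨2 * i + 1, by omega, ?_, ?_, ?_, h4⟩
        · push_cast
          rw [hmid, hlen]
          ring
        · simp only
          linarith
        · by_contra hlt
          exact hc (hd.1 (not_le.1 hlt))
  obtain ⟨i, -, -, h2, h3, h4⟩ := key L le_rfl p hp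
  rw [abs_le]
  constructor <;> linarith

/-! ### The input arrays -/

theorem lookup_intCast (A : ℤ → ℝ) (z : ℤ) : lookup A z = A z := by simp [lookup]

theorem lookup_natCast (A : ℤ → ℝ) (k : ℕ) : lookup A k = A k := by
  simpa using lookup_intCast A k

/-- The bound on `J_k` keeps every phase lookup inside the table, whose entries are `0` beyond `|j|
≤ d`. -/
theorem sum_arrayTerm {d M : ℕ} {δ : ℝ} {w : Fin M → ℤ × ℂ} (hw : ∀ k, |((w k).1 : ℝ)| ≤ d)
    (x : ℝ) : (∑ i ∈ Finset.range M, arrayTerm (inputArrays d δ w) x i) * coeffNorm d δ =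
      estimate d δ w x := by
  rw [estimate, mul_comm, Finset.sum_range]
  congr 1
  refine Finset.sum_congr rfl fun k _ => ?_
  have hk : |(w k).1| ≤ (d : ℤ) := by exact_mod_cast hw k
  have e0 : lookup (inputArrays d δ w 0) (k : ℕ) = (w k).1 := by
    rw [lookup_natCast]
    simp [inputArrays]
  have e1 : lookup (inputArrays d δ w 1) (k : ℕ) = (w k).2.re := by
    rw [lookup_natCast]
    simp [inputArrays]
  have e2 : lookup (inputArrays d δ w 2) (k : ℕ) = (w k).2.im := by
    rw [lookup_natCast]
    simp [inputArrays]
  have e3 : lookup (inputArrays d δ w 3) ((w k).1 : ℝ) = (coeff d δ (w k).1).arg := by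
    rw [lookup_intCast]
    simp [inputArrays, hk]
  rw [arrayTerm, e0, e1, e2, e3, estimateTerm]

end GroundEnergy

namespace GroundEnergy

open MeasureTheory

/-! ### The size of the parameters -/

section Parameters

variable {ε τ η ϑ : ℝ}

theorem lt_inv_mul_inv (hτ : 0 < τ) (hε : 0 < ε) (h : τ * ε < Real.pi / 6) :
    1.9 < ε⁻¹ * τ⁻¹ := by
  have hp : 0 < τ * ε := mul_pos hτ hε
  rw [← mul_inv, mul_comm, lt_inv_comm₀ (by norm_num) hp]
  refine h.trans ?_
  have := Real.pi_lt_d2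
  norm_num at this ⊢
  linarith

theorem half_le_log {r : ℝ} (hr : 1.9 < r) : 1 / 2 ≤ Real.log r := by
  rw [Real.le_log_iff_exp_le (by linarith)]
  refine le_trans ?_ hr.le
  refine (pow_le_pow_iff_left₀ (Real.exp_pos _).le (by norm_num) two_ne_zero).1 ?_
  rw [← Real.exp_nat_mul]
  norm_num
  linarith [Real.exp_one_lt_d9]

theorem le_inv_mul_inv_mul_inv (hτ : 0 < τ) (hε : 0 < ε) (hη : 0 < η) (hη1 : η ≤ 1) :
    ε⁻¹ * τ⁻¹ ≤ ε⁻¹ * τ⁻¹ * η⁻¹ :=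
  le_mul_of_one_le_right (by positivity) ((one_le_inv₀ hη).2 hη1)

theorem exp_five_ge : 148 ≤ Real.exp 5 := by
  have h := Real.exp_one_gt_d9
  have e : Real.exp 5 = Real.exp 1 ^ 5 := by rw [← Real.exp_nat_mul]; norm_num
  rw [e]
  exact le_trans (by norm_num) (pow_le_pow_left₀ (by norm_num) h.le 5)

theorem le_degree (A : ℝ) (ε τ η : ℝ) :
    A * ε⁻¹ * τ⁻¹ * Real.log (ε⁻¹ * τ⁻¹ * η⁻¹) ≤ degree A ε τ η := Nat.le_ceil _

theorem degree_le (hτ : 0 < τ) (hε : 0 < ε) (h : τ * ε < Real.pi / 6) (hη : 0 < η)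
    (hη1 : η ≤ 1) :
    (degree 66 ε τ η : ℝ) ≤ 66 * (ε⁻¹ * τ⁻¹) * Real.log (ε⁻¹ * τ⁻¹ * η⁻¹) + 1 := by
  have h1 := lt_inv_mul_inv hτ hε h
  have h2 := half_le_log (h1.trans_le (le_inv_mul_inv_mul_inv hτ hε hη hη1))
  refine (Nat.ceil_lt_add_one ?_).le.trans (le_of_eq (by ring))
  have : 0 ≤ Real.log (ε⁻¹ * τ⁻¹ * η⁻¹) := by linarith
  positivity

theorem three_le_log_degree (hτ : 0 < τ) (hε : 0 < ε) (h : τ * ε < Real.pi / 6) (hη : 0 < η)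
    (hη1 : η ≤ 1) : 3 ≤ Real.log (degree 66 ε τ η) := by
  have h1 := lt_inv_mul_inv hτ hε h
  have h2 := half_le_log (h1.trans_le (le_inv_mul_inv_mul_inv hτ hε hη hη1))
  have h3 := le_degree 66 ε τ η
  have h4 : 60 ≤ (degree 66 ε τ η : ℝ) := by
    refine le_trans ?_ h3
    rw [mul_assoc 66]
    nlinarith
  rw [Real.le_log_iff_exp_le (by linarith)]
  refine le_trans ?_ h4
  have e : Real.exp 3 = Real.exp 1 ^ 3 := by rw [← Real.exp_nat_mul]; norm_num
  rw [e]
  exact (pow_le_pow_left₀ (Real.exp_pos 1).le Real.exp_one_lt_d9.le 3).trans (by norm_num)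

theorem log_degree_le (hτ : 0 < τ) (hε : 0 < ε) (h : τ * ε < Real.pi / 6) (hη : 0 < η)
    (hη1 : η ≤ 1) :
    Real.log (degree 66 ε τ η) ≤ 12 * Real.log (ε⁻¹ * τ⁻¹ * η⁻¹) := by
  have h1 := lt_inv_mul_inv hτ hε h
  have h2 := le_inv_mul_inv_mul_inv hτ hε hη hη1
  have h3 := half_le_log (h1.trans_le h2)
  have h4 := degree_le hτ hε h hη hη1
  set q := ε⁻¹ * τ⁻¹ * η⁻¹
  set r := ε⁻¹ * τ⁻¹
  have hq : 1.9 < q := h1.trans_le h2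
  have h5 : Real.log q ≤ q := Real.log_le_self (by linarith)
  have hd : 0 < (degree 66 ε τ η : ℝ) := by
    -- Degree zero is excluded because `Real.log 0 = 0` contradicts the bound `3 ≤ log d`.
    rcases (Nat.cast_nonneg (α := ℝ) (degree 66 ε τ η)).eq_or_lt with h0 | h0
    · have := three_le_log_degree hτ hε h hη hη1
      rw [← h0, Real.log_zero] at this
      linarith
    · exact h0
  have h6 : (degree 66 ε τ η : ℝ) ≤ Real.exp 5 * q ^ 2 := by
    have : r * Real.log q ≤ q * q := by
      apply mul_le_mul h2 h5 (by linarith) (by linarith)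
    nlinarith [exp_five_ge]
  have h7 := Real.log_le_log hd h6
  rw [Real.log_mul (Real.exp_pos 5).ne' (by positivity), Real.log_exp, Real.log_pow] at h7
  push_cast at h7
  linarith

theorem tau_mul_degree_le (hτ : 0 < τ) (hε : 0 < ε) (h : τ * ε < Real.pi / 6) (hη : 0 < η)
    (hη1 : η ≤ 1) :
    τ * degree 66 ε τ η ≤ 68 * (ε⁻¹ * Real.log (ε⁻¹ * τ⁻¹ * η⁻¹)) := by
  have h1 := lt_inv_mul_inv hτ hε h
  have h3 := half_le_log (h1.trans_le (le_inv_mul_inv_mul_inv hτ hε hη hη1))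
  have h4 := mul_le_mul_of_nonneg_left (degree_le hτ hε h hη hη1) hτ.le
  set Λ := Real.log (ε⁻¹ * τ⁻¹ * η⁻¹)
  have h5 : τ ≤ ε⁻¹ := by
    rw [le_inv_comm₀ hτ hε, ← one_div, le_div_iff₀ hτ]
    linarith [Real.pi_lt_four]
  have h6 : 0 < ε⁻¹ := inv_pos.2 hε
  have e : τ * (66 * (ε⁻¹ * τ⁻¹) * Λ + 1) = 66 * (ε⁻¹ * Λ) + τ := by
    field_simp
  rw [e] at h4
  nlinarith

theorem numSamples_le (hτ : 0 < τ) (hε : 0 < ε) (h : τ * ε < Real.pi / 6) (hη : 0 < η)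
    (hη1 : η ≤ 1) (hϑ : 0 < ϑ) (hϑ1 : ϑ < 1) :
    (numSamples 6912 ε τ η ϑ (degree 66 ε τ η) : ℝ) ≤
      2000000 * ((η ^ 2)⁻¹ * Real.log (ε⁻¹ * τ⁻¹ * η⁻¹) ^ 3 * (1 + Real.log ϑ⁻¹)) := by
  have h1 := lt_inv_mul_inv hτ hε h
  have h2 := le_inv_mul_inv_mul_inv hτ hε hη hη1
  have h3 := half_le_log (h1.trans_le h2)
  have h4 := log_degree_le hτ hε h hη hη1
  have h5 := three_le_log_degree hτ hε h hη hη1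
  have h6 : Real.log (ε⁻¹ * τ⁻¹) ≤ Real.log (ε⁻¹ * τ⁻¹ * η⁻¹) :=
    Real.log_le_log (by linarith) h2
  have h7 : Real.log (Real.log (ε⁻¹ * τ⁻¹)) ≤ Real.log (ε⁻¹ * τ⁻¹) :=
    Real.log_le_self (by linarith [half_le_log h1])
  have hl : 0 ≤ Real.log ϑ⁻¹ := Real.log_nonneg ((one_le_inv₀ hϑ).2 hϑ1.le)
  have hη2 : 1 ≤ (η ^ 2)⁻¹ := (one_le_inv₀ (by positivity)).2 (pow_le_one₀ hη.le hη1)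
  unfold numSamples
  set Λ := Real.log (ε⁻¹ * τ⁻¹ * η⁻¹)
  set D := Real.log (degree 66 ε τ η)
  set N := (η ^ 2)⁻¹
  set K := Real.log ϑ⁻¹
  -- Of the three powers of `Λ`, two come from `log² d` and one from this bound; `1 ≤ 2Λ` is used
  -- throughout.
  have hm : max 1 (Real.log (Real.log (ε⁻¹ * τ⁻¹)) + K) ≤ 2 * Λ * (1 + K) := by
    apply max_le <;> nlinarith
  have hD : D ^ 2 ≤ (12 * Λ) ^ 2 := pow_le_pow_left₀ (by linarith) h4 2
  refine (Nat.ceil_lt_add_one ?_).le.trans ?_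
  · positivity
  have hb : 6912 * N * D ^ 2 * max 1 (Real.log (Real.log (ε⁻¹ * τ⁻¹)) + K) ≤
      6912 * N * (12 * Λ) ^ 2 * (2 * Λ * (1 + K)) := by
    apply mul_le_mul _ hm (by positivity) (by positivity)
    exact mul_le_mul_of_nonneg_left hD (by positivity)
  have hΛ : 1 / 8 ≤ Λ ^ 3 := by
    have := pow_le_pow_left₀ (by norm_num) h3 3
    norm_num at this ⊢
    exact this
  have hX : 1 / 8 ≤ N * Λ ^ 3 * (1 + K) := by
    calc (1 : ℝ) / 8 = 1 * (1 / 8) * 1 := by norm_num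
      _ ≤ N * Λ ^ 3 * (1 + K) := by gcongr; linarith
  have e : 6912 * N * (12 * Λ) ^ 2 * (2 * Λ * (1 + K)) = 1990656 * (N * Λ ^ 3 * (1 + K)) := by
    ring
  rw [e] at hb
  linarith

/-- The constant `66` gives `d δ/4 ≥ 11 log q` with `q = ε⁻¹τ⁻¹η⁻¹`. One factor `q` cancels `τε` and
leaves `1/η`; the other ten give `q¹⁰ ≥ 1.9¹⁰ ≥ 600`, hence `200/η` before subtracting `2π`. -/
theorem le_bumpIntegral_degree (hτ : 0 < τ) (hε : 0 < ε) (h : τ * ε < Real.pi / 6) (hη : 0 < η)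
    (hη1 : η ≤ 1) :
    60 / η ≤ bumpIntegral (degree 66 ε τ η) (2 / 3 * (τ * ε)) := by
  have h1 := lt_inv_mul_inv hτ hε h
  have h2 := le_inv_mul_inv_mul_inv hτ hε hη hη1
  have hd := le_degree 66 ε τ η
  have hp : 0 < τ * ε := mul_pos hτ hε
  have hpi := Real.pi_lt_four
  refine le_trans ?_ (le_bumpIntegral (by positivity) (by linarith))
  have hq : (1.9 : ℝ) < ε⁻¹ * τ⁻¹ * η⁻¹ := h1.trans_le h2
  have he : 11 * Real.log (ε⁻¹ * τ⁻¹ * η⁻¹) ≤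
      (degree 66 ε τ η : ℝ) * (2 / 3 * (τ * ε) / 4) := by
    calc 11 * Real.log (ε⁻¹ * τ⁻¹ * η⁻¹) =
        66 * ε⁻¹ * τ⁻¹ * Real.log (ε⁻¹ * τ⁻¹ * η⁻¹) * (2 / 3 * (τ * ε) / 4) := by
          field_simp
          ring
      _ ≤ _ := mul_le_mul_of_nonneg_right hd (by positivity)
  have hexp := Real.exp_le_exp.2 he
  have e1 : Real.exp (11 * Real.log (ε⁻¹ * τ⁻¹ * η⁻¹)) = (ε⁻¹ * τ⁻¹ * η⁻¹) ^ 11 := by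
    rw [show (11 : ℝ) = ((11 : ℕ) : ℝ) by norm_num, Real.exp_nat_mul,
      Real.exp_log (by linarith)]
  rw [e1] at hexp
  have hpow : (600 : ℝ) ≤ (ε⁻¹ * τ⁻¹ * η⁻¹) ^ 10 :=
    le_trans (by norm_num) (pow_le_pow_left₀ (by norm_num) hq.le 10)
  have e2 : 2 / 3 * (τ * ε) * (ε⁻¹ * τ⁻¹ * η⁻¹) ^ 11 / 2 =
      (ε⁻¹ * τ⁻¹ * η⁻¹) ^ 10 / (3 * η) := by
    rw [pow_succ]
    generalize (ε⁻¹ * τ⁻¹ * η⁻¹) ^ 10 = P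
    field_simp
  have h3 : 2 / 3 * (τ * ε) * (ε⁻¹ * τ⁻¹ * η⁻¹) ^ 11 / 2 ≤
      2 / 3 * (τ * ε) * Real.exp ((degree 66 ε τ η : ℝ) * (2 / 3 * (τ * ε) / 4)) / 2 := by
    gcongr
  rw [e2] at h3
  have h4 : 600 / (3 * η) ≤ (ε⁻¹ * τ⁻¹ * η⁻¹) ^ 10 / (3 * η) := by gcongr
  have h5 : 600 / (3 * η) = 200 * η⁻¹ := by field_simp; norm_num
  have h6 : 1 ≤ η⁻¹ := (one_le_inv₀ hη).2 hη1
  rw [div_eq_mul_inv]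
  linarith

/-- The number of bisection steps. -/
theorem exists_numSteps {δ : ℝ} (hδ : 0 < δ) :
    ∃ L : ℕ, 3 / 2 ^ L ≤ δ ∧ (∀ l < L, δ < 3 / 2 ^ l) := by
  have h : ∃ L : ℕ, 3 / 2 ^ L ≤ δ := by
    obtain ⟨n, hn⟩ := pow_unbounded_of_one_lt (3 / δ) (one_lt_two : (1 : ℝ) < 2)
    refine ⟨n, ?_⟩
    rw [div_lt_iff₀ hδ] at hn
    rw [div_le_iff₀ (by positivity)]
    linarith
  classical
  exact ⟨Nat.find h, Nat.find_spec h, fun l hl => not_le.1 (Nat.find_min h hl)⟩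

theorem numSteps_le (hτ : 0 < τ) (hε : 0 < ε) (h : τ * ε < Real.pi / 6) {L : ℕ}
    (hL : ∀ l < L, 2 / 3 * (τ * ε) < 3 / 2 ^ l) : (L : ℝ) ≤ 11 * Real.log (ε⁻¹ * τ⁻¹) := by
  have h1 := lt_inv_mul_inv hτ hε h
  have h2 := half_le_log h1
  have hp : 0 < τ * ε := mul_pos hτ hε
  rcases Nat.eq_zero_or_pos L with rfl | hpos
  · simp only [Nat.cast_zero]
    linarith
  have h3 := hL (L - 1) (by omega)
  -- The last unfinished level `L - 1` satisfies `δ < 3/2^(L-1)`, that is, `2^L < 6/δ = 9/(τε)`.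
  have h4 : (2 : ℝ) ^ L ≤ 9 * (ε⁻¹ * τ⁻¹) := by
    have e : (2 : ℝ) ^ L = 2 * 2 ^ (L - 1) := by rw [← pow_succ']; congr 1; omega
    rw [lt_div_iff₀ (by positivity)] at h3
    rw [e, ← mul_inv, mul_comm ε τ, ← div_eq_mul_inv, le_div_iff₀ hp]
    linarith
  have h5 := Real.log_le_log (by positivity) h4
  rw [Real.log_pow, Real.log_mul (by norm_num) (by linarith)] at h5
  have h6 : Real.log 9 ≤ 3 := by
    rw [Real.log_le_iff_le_exp (by norm_num)]
    have e : Real.exp 3 = Real.exp 1 ^ 3 := by rw [← Real.exp_nat_mul]; norm_num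
    rw [e]
    exact le_trans (by norm_num)
      (pow_le_pow_left₀ (by norm_num) Real.exp_one_gt_d9.le 3)
  have h7 := Real.log_two_gt_d9
  have h8 : (0 : ℝ) ≤ L := Nat.cast_nonneg L
  nlinarith

/-- Since `6912 = 6 · 128 · 3²`, the exponent is at least `6m`. One `e^{-m}` absorbs `u/ϑ`, the
remaining `e^{-5m} ≤ 1/148` absorbs `4 · 2 · 11 = 88`. -/
theorem union_bound_le (hη : 0 < η) (hϑ : 0 < ϑ) {u D N : ℝ} {M L : ℕ} (hu : 1 / 2 ≤ u)
    (hD : 3 ≤ D) (hN0 : 0 < N) (hN : N ≤ 3 * D) (hL : (L : ℝ) ≤ 11 * u)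
    (hM : 6912 * (η ^ 2)⁻¹ * D ^ 2 * max 1 (Real.log u + Real.log ϑ⁻¹) ≤ M) :
    (L * 4 : ℕ) * (2 * Real.exp (-(M * η ^ 2 / (128 * N ^ 2)))) ≤ ϑ := by
  set m := max 1 (Real.log u + Real.log ϑ⁻¹)
  have hm1 : 1 ≤ m := le_max_left _ _
  have h1 : u ≤ ϑ * Real.exp m := by
    have : Real.log u + Real.log ϑ⁻¹ ≤ m := le_max_right _ _
    rw [Real.log_inv] at this
    have h2 := Real.exp_le_exp.2 (show Real.log u ≤ Real.log ϑ + m by linarith)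
    rwa [Real.exp_add, Real.exp_log (by linarith), Real.exp_log hϑ] at h2
  have h2 : 6 * m ≤ M * η ^ 2 / (128 * N ^ 2) := by
    rw [le_div_iff₀ (by positivity)]
    have h3 : N ^ 2 ≤ (3 * D) ^ 2 := pow_le_pow_left₀ hN0.le hN 2
    calc 6 * m * (128 * N ^ 2) ≤ 6 * m * (128 * (3 * D) ^ 2) := by gcongr
      _ = 6912 * (η ^ 2)⁻¹ * D ^ 2 * m * η ^ 2 := by field_simp; ring
      _ ≤ M * η ^ 2 := by gcongr
  have h3 : Real.exp (-(M * η ^ 2 / (128 * N ^ 2))) ≤ Real.exp (-m) * (Real.exp 5)⁻¹ := by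
    rw [← Real.exp_neg, ← Real.exp_add]
    exact Real.exp_le_exp.2 (by linarith)
  have h4 : (Real.exp 5)⁻¹ ≤ 148⁻¹ := inv_anti₀ (by norm_num) exp_five_ge
  push_cast
  calc (L : ℝ) * 4 * (2 * Real.exp (-(M * η ^ 2 / (128 * N ^ 2)))) ≤
      11 * (ϑ * Real.exp m) * 4 * (2 * (Real.exp (-m) * 148⁻¹)) := by
        gcongr
        · linarith
        · exact h3.trans (by gcongr)
    _ = ϑ * (88 / 148) * (Real.exp m * Real.exp (-m)) := by ring
    _ = ϑ * (88 / 148) := by rw [← Real.exp_add, add_neg_cancel, Real.exp_zero, mul_one]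
    _ ≤ ϑ := by linarith

end Parameters

/-! ### The relevant query points -/

/-- The midpoint of the `i`-th interval at level `l` of the bisection. -/
def queryPoint (l i : ℕ) : ℝ := -3 / 2 + (i + 1 / 2) * (3 / 2 ^ l)

open Classical in
/-- The intervals at level `l` which the bisection can reach. -/
def reachable (e : ℝ) (l : ℕ) : Finset ℕ :=
  (Finset.range (2 ^ l)).filter fun i => |queryPoint l i - e| ≤ 3 / 2 * (3 / 2 ^ l)

theorem card_reachable_le (e : ℝ) (l : ℕ) : (reachable e l).card ≤ 4 := by
  set c : ℝ := (e + 3 / 2) / (3 / 2 ^ l) - 2 with hc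
  have hlen : (0 : ℝ) < 3 / 2 ^ l := by positivity
  -- In units of the interval length, the index lies in `[c, c + 3]`, which contains at most four
  -- integers.
  have hsub : reachable e l ⊆ Finset.Icc ⌈c⌉₊ (⌈c⌉₊ + 3) := by
    intro i hi
    have h := abs_le.1 (Finset.mem_filter.1 hi).2
    unfold queryPoint at h
    have e1 : e + 3 / 2 = (c + 2) * (3 / 2 ^ l) := by
      rw [hc]
      field_simp
      ring
    have h1 : c ≤ i := by
      have : (c + 2) * (3 / 2 ^ l) ≤ (i + 2) * (3 / 2 ^ l) := by linarith
      linarith [le_of_mul_le_mul_right this hlen]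
    have h2 : (i : ℝ) ≤ c + 3 := by
      have : (i : ℝ) * (3 / 2 ^ l) ≤ (c + 3) * (3 / 2 ^ l) := by linarith
      exact le_of_mul_le_mul_right this hlen
    rw [Finset.mem_Icc]
    refine ⟨Nat.ceil_le.2 h1, ?_⟩
    have h3 : (i : ℝ) ≤ ((⌈c⌉₊ + 3 : ℕ) : ℝ) := by
      push_cast
      linarith [Nat.le_ceil c]
    exact_mod_cast h3
  refine (Finset.card_le_card hsub).trans ?_
  rw [Nat.card_Icc]
  omega

theorem abs_queryPoint_le {l i : ℕ} (hi : i < 2 ^ l) : |queryPoint l i| ≤ 3 / 2 := by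
  have h1 : ((i : ℝ) + 1) ≤ 2 ^ l := by exact_mod_cast hi
  have h2 : ((i : ℝ) + 1 / 2) * (3 / 2 ^ l) ≤ 3 := by
    rw [mul_div_assoc', div_le_iff₀ (by positivity)]
    linarith
  have h3 : 0 ≤ ((i : ℝ) + 1 / 2) * (3 / 2 ^ l) := by positivity
  unfold queryPoint
  rw [abs_le]
  constructor <;> linarith

end GroundEnergy

namespace GroundEnergy

open MeasureTheory

/-! ### Accuracy -/

section

variable {ι : Type} [Fintype ι] [DecidableEq ι] {H ρ : Matrix ι ι ℂ} {E₀ τ ε η : ℝ}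

theorem eigenvalues_of_isLeast (hH : H.IsHermitian) (hE : IsLeast (spectrum ℝ H) E₀) :
    (∀ k, E₀ ≤ hH.eigenvalues k) ∧ |E₀| ≤ opNorm H := by
  rw [hH.spectrum_real_eq_range_eigenvalues] at hE
  refine ⟨fun k => hE.2 ⟨k, rfl⟩, ?_⟩
  obtain ⟨k, hk⟩ := hE.1
  rw [← hk]
  exact abs_eigenvalues_le_opNorm hH k

theorem le_one_of_le_overlap (hH : H.IsHermitian) (hρ : ρ.PosSemidef) (h1 : ρ.trace = 1)
    (hη : η ≤ (ρ * eigenProj H E₀).trace.re) : η ≤ 1 := by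
  refine hη.trans ?_
  rw [trace_mul_eigenProj_re hH hρ, ← sum_eigenWeight hH hρ h1]
  refine Finset.sum_le_sum fun k _ => ?_
  split_ifs
  · exact le_rfl
  · exact (eigenWeight_spec hH hρ k).1

/-- If the estimates are accurate at all points which the bisection can reach, then so is the
output. -/
theorem output_accurate (hH : H.IsHermitian) (hρ : ρ.PosSemidef) (h1 : ρ.trace = 1)
    (hE : IsLeast (spectrum ℝ H) E₀) (hτ : 0 < τ) (hτH : τ * opNorm H < Real.pi / 3)
    (hε : 0 < ε) (hτε : τ * ε < Real.pi / 6) (hη : 0 < η)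
    (hp : η ≤ (ρ * eigenProj H E₀).trace.re) {d M L : ℕ} {δ : ℝ} (hδ : δ = 2 / 3 * (τ * ε))
    (hI : 60 / η ≤ bumpIntegral d δ) (ϑ : ℝ) (hfine : 3 / 2 ^ L ≤ δ)
    (hgo : ∀ l < L, δ < 3 / 2 ^ l) {w : Fin M → ℤ × ℂ} (hw : ∀ k, |((w k).1 : ℝ)| ≤ d)
    (hgood : ∀ l < L, ∀ i ∈ reachable (τ * E₀) l,
      |estimate d δ w (queryPoint l i) - M * smoothedCDF hH ρ τ d δ (queryPoint l i)| <
        M * (η / 4)) :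
    ∃ (s : ℕ → ℝ) (t : ℕ), Exec (inputArrays d δ w) groundEnergyProg (initRegs ε τ η ϑ d δ M) s t ∧
      |s 0 - E₀| ≤ ε := by
  obtain ⟨hlow, hE₀⟩ := eigenvalues_of_isLeast hH hE
  have hpi3 := Real.pi_gt_three
  have hpi4 := Real.pi_lt_four
  have hpi := Real.pi_lt_d2
  have hδ0 : 0 < δ := by rw [hδ]; positivity
  have hδ1 : δ < Real.pi / 9 := by rw [hδ]; linarith
  have hcos : 0 < 1 + Real.cos δ := by
    have := Real.cos_pos_of_le_one (x := δ) (by rw [abs_of_pos hδ0]; linarith)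
    linarith
  have hI0 : 0 < bumpIntegral d δ := lt_of_lt_of_le (by positivity) hI
  have hsmall : Real.pi / bumpIntegral d δ ≤ η / 15 := by
    rw [div_le_iff₀ hI0]
    rw [div_le_iff₀ hη] at hI
    linarith
  have heig : ∀ k, |τ * hH.eigenvalues k| < Real.pi / 3 := fun k => by
    rw [abs_mul, abs_of_pos hτ]
    exact (mul_le_mul_of_nonneg_left (abs_eigenvalues_le_opNorm hH k) hτ.le).trans_lt hτH
  have he : |τ * E₀| < Real.pi / 3 := by
    rw [abs_mul, abs_of_pos hτ]
    exact (mul_le_mul_of_nonneg_left hE₀ hτ.le).trans_lt hτH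
  obtain ⟨s, hs, hout⟩ := exec_groundEnergyProg (inputArrays d δ w) ε τ η ϑ d δ M L hδ hfine hgo
  refine ⟨s, _, hs, ?_⟩
  simp only [sum_arrayTerm hw] at hout
  have key := abs_bisect_sub_le (e := τ * E₀)
    (dec := fun x => η * (1 / 2) * M < estimate d δ w x) hδ0.le hfine hgo (by linarith)
    (fun l hl i hi x hx hxe => by
      change x = queryPoint l i at hx
      subst hx
      have hx := abs_le.1 (abs_queryPoint_le hi)
      have he' := abs_lt.1 he
      have hM : (0 : ℝ) ≤ M := Nat.cast_nonneg M
      have hMη : 0 ≤ M * η := by positivity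
      have hg := abs_lt.1
        (hgood l hl i (Finset.mem_filter.2 ⟨Finset.mem_range.2 hi, hxe⟩))
      constructor
      · intro hgt
        -- All queries lie in `[-3/2, 3/2]`, and `3/2 + π/3 ≤ π - δ` as `δ < π/9`, so the other jump
        -- of the periodic Heaviside function is never met, here or below.
        have := le_smoothedCDF hH hρ h1 hδ0.le hcos hI0 hgt.le (by linarith)
        have h2 := mul_le_mul_of_nonneg_left
          (show η - η / 15 ≤ smoothedCDF hH ρ τ d δ (queryPoint l i) by linarith) hM
        nlinarith [hg.1]
      · intro hlt hdec
        have := smoothedCDF_le hH hρ h1 hδ0.le hcos hI0 hlow hτ.le hlt.le (fun k => by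
          have := abs_lt.1 (heig k)
          linarith)
        have h2 := mul_le_mul_of_nonneg_left
          (show smoothedCDF hH ρ τ d δ (queryPoint l i) ≤ η / 15 by linarith) hM
        nlinarith [hg.2]) rfl
  rw [hout _ rfl]
  set y := (_ : ℝ) * (1 / 2)
  have e : y / τ - E₀ = (y - τ * E₀) / τ := by field_simp
  rw [e, abs_div, abs_of_pos hτ, div_le_iff₀ hτ]
  refine key.trans (le_of_eq ?_)
  rw [hδ]
  ring

theorem ae_samplesLaw (τ : ℝ) (d : ℕ) (δ : ℝ) (M : ℕ)
    [IsProbabilityMeasure (sampleLaw H ρ τ d δ)] :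
    ∀ᵐ w ∂(samplesLaw H ρ τ d δ M), ∀ k, |((w k).1 : ℝ)| ≤ d := by
  rw [ae_all_iff]
  intro k
  filter_upwards [(Measure.tendsto_eval_ae_ae (μ := fun _ : Fin M => sampleLaw H ρ τ d δ)
    (i := k)).eventually (ae_sampleLaw (H := H) (ρ := ρ) τ d δ)] with w hw
  exact hw.1

/-- The probability that some estimate is inaccurate at a point which the bisection can reach. -/
theorem measure_inaccurate_le (hH : H.IsHermitian) (hρ : ρ.PosSemidef) (h1 : ρ.trace = 1)
    (τ : ℝ) {d : ℕ} {δ : ℝ} (hN : 0 < coeffNorm d δ) (M L : ℕ) (e : ℝ) (hη : 0 ≤ η) :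
    (samplesLaw H ρ τ d δ M).real (⋃ q ∈ (Finset.range L).sigma (reachable e),
      {w | M * (η / 4) ≤ |estimate d δ w (queryPoint q.1 q.2) -
        M * smoothedCDF hH ρ τ d δ (queryPoint q.1 q.2)|}) ≤
      (L * 4 : ℕ) * (2 * Real.exp (-(M * η ^ 2 / (128 * coeffNorm d δ ^ 2)))) := by
  refine (measureReal_biUnion_finset_le _ _).trans ?_
  refine (Finset.sum_le_card_nsmul _ _ _
    fun q _ => estimate_deviation hH hρ h1 τ hN M _ hη).trans ?_
  rw [nsmul_eq_mul]
  refine mul_le_mul_of_nonneg_right ?_ (by positivity)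
  rw [Finset.card_sigma]
  have := Finset.sum_le_card_nsmul (Finset.range L) (fun l => (reachable e l).card) 4
    fun l _ => card_reachable_le e l
  rw [Finset.card_range, smul_eq_mul] at this
  exact_mod_cast this

end

end GroundEnergy

end

/-! ### Assembly of the four claims -/

theorem mainTheorem1 :
    ∃ (A B C : ℝ) (m : ℕ) (prog : Prog), 0 < A ∧ 0 < B ∧ 0 < C ∧
      ∀ (ι : Type) [Fintype ι] [DecidableEq ι] (H ρ : Matrix ι ι ℂ) (E₀ τ ε η ϑ : ℝ),
        H.IsHermitian → ρ.PosSemidef → ρ.trace = 1 →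
        IsLeast (spectrum ℝ H) E₀ →
        0 < τ → τ * opNorm H < Real.pi / 3 →
        0 < ε → τ * ε < Real.pi / 6 →
        0 < η → η ≤ (ρ * eigenProj H E₀).trace.re →
        0 < ϑ → ϑ < 1 →
        ∀ (δ : ℝ) (d M : ℕ), δ = 2 / 3 * (τ * ε) → d = degree A ε τ η →
          M = numSamples B ε τ η ϑ d →
          -- the samples have a well-defined distribution
          MeasureTheory.IsProbabilityMeasure (sampleLaw H ρ τ d δ) ∧
          -- the estimate is accurate with probability at least `1 - ϑ`
          1 - ϑ ≤ (samplesLaw H ρ τ d δ M).real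
            {w | ∃ (s : ℕ → ℝ) (t : ℕ),
              Exec (inputArrays d δ w) prog (initRegs ε τ η ϑ d δ M) s t ∧ |s 0 - E₀| ≤ ε} ∧
          -- classical post-processing cost, for all values of the samples
          (∀ w : Fin M → ℤ × ℂ, ∃ (s : ℕ → ℝ) (t : ℕ),
            Exec (inputArrays d δ w) prog (initRegs ε τ η ϑ d δ M) s t ∧
            (t : ℝ) ≤ C * (η ^ 2)⁻¹ * Real.log (ε⁻¹ * τ⁻¹ * η⁻¹) ^ m * (1 + Real.log ϑ⁻¹)) ∧
          -- expected total evolution time (each sample takes two runs of the circuit)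
          ∫⁻ w, ENNReal.ofReal (∑ k, 2 * (τ * |((w k).1 : ℝ)|)) ∂(samplesLaw H ρ τ d δ M) ≤
            ENNReal.ofReal (C * ε⁻¹ * (η ^ 2)⁻¹ * Real.log (ε⁻¹ * τ⁻¹ * η⁻¹) ^ m
              * (1 + Real.log ϑ⁻¹)) ∧
          -- maximal evolution time
          (∀ᵐ w ∂(samplesLaw H ρ τ d δ M), ∀ k, τ * |((w k).1 : ℝ)| ≤ τ * d) ∧
          τ * d ≤ C * ε⁻¹ * Real.log (ε⁻¹ * τ⁻¹ * η⁻¹) ^ m := by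
  -- The exponent `4` is `3` from `M` plus `1` from the number of bisection steps or from `τd`;
  -- `10⁹` is a generous common constant.
  refine ⟨66, 6912, 1000000000, 4, groundEnergyProg, by norm_num, by norm_num, by norm_num, ?_⟩
  intro ι _ _ H ρ E₀ τ ε η ϑ hH hρ h1 hE hτ hτH hε hτε hη hp hϑ hϑ1 δ d M hδ hd hM
  have hη1 := le_one_of_le_overlap hH hρ h1 hp
  have hI : 60 / η ≤ bumpIntegral d δ := by
    rw [hd, hδ]
    exact le_bumpIntegral_degree hτ hε hτε hη hη1
  have hI60 : 60 ≤ bumpIntegral d δ := by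
    refine le_trans ?_ hI
    rw [le_div_iff₀ hη]
    linarith
  have hpi4 := Real.pi_lt_four
  have hδ0 : 0 < δ := by rw [hδ]; positivity
  have hδ1 : δ < 1 := by rw [hδ]; linarith
  have hcos : 0 < 1 + Real.cos δ := by
    have := Real.cos_pos_of_le_one (x := δ) (by rw [abs_of_pos hδ0]; linarith)
    linarith
  have hI0 : 0 < bumpIntegral d δ := by linarith
  have hN := coeffNorm_pos hI0
  have hprob := isProbabilityMeasure_sampleLaw hH hρ h1 τ hN
  have hprobs : MeasureTheory.IsProbabilityMeasure (samplesLaw H ρ τ d δ M) := by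
    unfold samplesLaw
    infer_instance
  have hae := ae_samplesLaw (H := H) (ρ := ρ) τ d δ M
  have hr := lt_inv_mul_inv hτ hε hτε
  have hqr := le_inv_mul_inv_mul_inv hτ hε hη hη1
  have hu := half_le_log hr
  have hΛ := half_le_log (hr.trans_le hqr)
  have huΛ : Real.log (ε⁻¹ * τ⁻¹) ≤ Real.log (ε⁻¹ * τ⁻¹ * η⁻¹) :=
    Real.log_le_log (by linarith) hqr
  have hD := three_le_log_degree hτ hε hτε hη hη1
  have hτd := tau_mul_degree_le hτ hε hτε hη hη1
  have hMle := numSamples_le hτ hε hτε hη hη1 hϑ hϑ1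
  rw [← hd] at hD hτd hMle
  rw [← hM] at hMle
  -- The additive `3` is absorbed using `3 ≤ log d`.
  have hNle : coeffNorm d δ ≤ 3 * Real.log d := by
    have := coeffNorm_le hI0 ((integral_abs_mollifier_le hcos hI0).trans (by
      have : 4 * Real.pi / bumpIntegral d δ ≤ 1 := by
        rw [div_le_one hI0]
        linarith
      linarith))
    linarith
  obtain ⟨L, hfine, hgo⟩ := exists_numSteps hδ0
  have hL := numSteps_le hτ hε hτε (L := L) (by rw [← hδ]; exact hgo)
  have hK : 0 ≤ Real.log ϑ⁻¹ := Real.log_nonneg ((one_le_inv₀ hϑ).2 hϑ1.le)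
  have hη2 : 1 ≤ (η ^ 2)⁻¹ := (one_le_inv₀ (by positivity)).2 (pow_le_one₀ hη.le hη1)
  set Λ := Real.log (ε⁻¹ * τ⁻¹ * η⁻¹)
  have hΛ3 : 1 / 8 ≤ Λ ^ 3 := by
    have := pow_le_pow_left₀ (by norm_num) hΛ 3
    norm_num at this ⊢
    exact this
  have hX : 1 ≤ (η ^ 2)⁻¹ * (1 + Real.log ϑ⁻¹) := one_le_mul_of_one_le_of_one_le hη2 (by linarith)
  set X := (η ^ 2)⁻¹ * (1 + Real.log ϑ⁻¹) with hXdef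
  have hY : 1 / 8 ≤ X * Λ ^ 3 := hΛ3.trans (le_mul_of_one_le_left (by linarith) hX)
  replace hMle : (M : ℝ) ≤ 2000000 * (X * Λ ^ 3) := by
    refine hMle.trans (le_of_eq ?_)
    rw [hXdef]
    ring
  have hε' : 0 < ε⁻¹ := inv_pos.2 hε
  refine ⟨hprob, ?_, ?_, ?_, ?_, ?_⟩
  · have hbad := (measure_inaccurate_le hH hρ h1 τ hN M L (τ * E₀) hη.le).trans
      (union_bound_le (D := Real.log d) hη hϑ hu hD hN hNle hL (by
        rw [hM]
        exact Nat.le_ceil _))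
    set bad := ⋃ q ∈ (Finset.range L).sigma (reachable (τ * E₀)),
      {w : Fin M → ℤ × ℂ | M * (η / 4) ≤ |estimate d δ w (queryPoint q.1 q.2) -
        M * smoothedCDF hH ρ τ d δ (queryPoint q.1 q.2)|} with hbad_def
    set good := {w : Fin M → ℤ × ℂ | ∃ (s : ℕ → ℝ) (t : ℕ),
      Exec (inputArrays d δ w) groundEnergyProg (initRegs ε τ η ϑ d δ M) s t ∧
        |s 0 - E₀| ≤ ε}
    -- Covering the whole space and using subadditivity bounds the success probability from below
    -- without measurability of the success event.
    have hcover : (Set.univ : Set (Fin M → ℤ × ℂ)) ⊆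
        (good ∪ bad) ∪ {w | ¬ ∀ k, |((w k).1 : ℝ)| ≤ d} := by
      intro w _
      by_cases hw : ∀ k, |((w k).1 : ℝ)| ≤ d
      · left
        by_cases hb : w ∈ bad
        · exact Or.inr hb
        · left
          refine output_accurate hH hρ h1 hE hτ hτH hε hτε hη hp hδ hI ϑ hfine hgo hw ?_
          intro l hl i hi
          by_contra hlt
          refine hb ?_
          rw [hbad_def, Set.mem_iUnion₂]
          exact ⟨⟨l, i⟩, Finset.mem_sigma.2 ⟨Finset.mem_range.2 hl, hi⟩, not_lt.1 hlt⟩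
      · exact Or.inr hw
    have hnull : (samplesLaw H ρ τ d δ M).real {w | ¬ ∀ k, |((w k).1 : ℝ)| ≤ d} = 0 := by
      rw [MeasureTheory.measureReal_def, MeasureTheory.ae_iff.1 hae]
      rfl
    have h2 := MeasureTheory.measureReal_mono (μ := samplesLaw H ρ τ d δ M) hcover
    have h3 := MeasureTheory.measureReal_union_le (μ := samplesLaw H ρ τ d δ M) (good ∪ bad)
      {w | ¬ ∀ k, |((w k).1 : ℝ)| ≤ d}
    have h4 := MeasureTheory.measureReal_union_le (μ := samplesLaw H ρ τ d δ M) good bad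
    rw [MeasureTheory.probReal_univ] at h2
    linarith
  · intro w
    obtain ⟨s, hs, -⟩ := exec_groundEnergyProg (inputArrays d δ w) ε τ η ϑ d δ M L hδ hfine hgo
    refine ⟨s, _, hs, ?_⟩
    have e : 1000000000 * (η ^ 2)⁻¹ * Λ ^ 4 * (1 + Real.log ϑ⁻¹) =
        1000000000 * (Λ * (X * Λ ^ 3)) := by
      rw [hXdef]
      ring
    rw [e]
    push_cast
    have h2 : (14 * (M : ℝ) + 10) ≤ 28000080 * (X * Λ ^ 3) := by linarith
    have h3 : (L : ℝ) * (14 * M + 10) ≤ 11 * Λ * (28000080 * (X * Λ ^ 3)) :=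
      mul_le_mul (hL.trans (by linarith)) h2 (by positivity) (by linarith)
    have h4 : 1 / 16 ≤ Λ * (X * Λ ^ 3) := by
      have := mul_le_mul hΛ hY (by norm_num) (by linarith)
      linarith
    linarith
  -- The expectation is bounded by the almost sure maximum `2 M τ d`.
  · calc ∫⁻ w, ENNReal.ofReal (∑ k, 2 * (τ * |((w k).1 : ℝ)|)) ∂(samplesLaw H ρ τ d δ M)
        ≤ ∫⁻ _, ENNReal.ofReal (M * (2 * (τ * d))) ∂(samplesLaw H ρ τ d δ M) := by
          refine MeasureTheory.lintegral_mono_ae ?_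
          filter_upwards [hae] with w hw
          refine ENNReal.ofReal_le_ofReal ?_
          refine (Finset.sum_le_card_nsmul _ _ (2 * (τ * d)) fun k _ => ?_).trans ?_
          · have := mul_le_mul_of_nonneg_left (hw k) hτ.le
            linarith
          · simp
      _ = ENNReal.ofReal (M * (2 * (τ * d))) := by simp
      _ ≤ _ := by
          refine ENNReal.ofReal_le_ofReal ?_
          have e : 1000000000 * ε⁻¹ * (η ^ 2)⁻¹ * Λ ^ 4 * (1 + Real.log ϑ⁻¹) =
              2000000 * (X * Λ ^ 3) * (500 * (ε⁻¹ * Λ)) := by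
            rw [hXdef]
            ring
          rw [e]
          have h2 : 0 ≤ ε⁻¹ * Λ := mul_nonneg hε'.le (by linarith)
          exact mul_le_mul hMle (by linarith) (by positivity) (by linarith)
  · filter_upwards [hae] with w hw k
    exact mul_le_mul_of_nonneg_left (hw k) hτ.le
  · refine hτd.trans ?_
    have e : 1000000000 * ε⁻¹ * Λ ^ 4 = 1000000000 * (ε⁻¹ * Λ) * Λ ^ 3 := by ring
    rw [e]
    have h2 : 0 ≤ ε⁻¹ * Λ := mul_nonneg hε'.le (by linarith)
    have h3 := mul_le_mul_of_nonneg_left hΛ3 h2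
    linarith
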